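/- \textbf{Model.} Consider a network with tiers $\mathcal K=\{1,\dots,K\}$ in $\mathbb R^2$ and path-loss exponent $\alpha>2$; put $\delta=2/\alpha$. The base stations (BSs) of tier $j$ form a homogeneous Poisson process $\Phi_j$ of density $\lambda_j>0$; they have $M_j\ge 2$ antennas, transmit power $P_j>0$ and power allocation ratio $\phi_j\in(0,1]$. Users and eavesdroppers (Eves), each with one antenna, form homogeneous Poisson processes $\Phi_u,\Phi_e$ of densities $\lambda_u,\lambda_e>0$, and all these processes are independent. A user at distance $r_j$ from the nearest BS of tier $j$ receives from that tier the truncated average power $\hat P_j=P_jM_jr_j^{-\alpha}$ if $r_j\le D_j=(P_jM_j/\tau)^{1/\alpha}$ and $\hat P_j=0$ otherwise (access threshold $\tau>0$), and it is associated with the BS that provides the largest $\hat P_j$, if this is positive. Let $\mathcal A_j$ be the probability that a (typical) BS of tier $j$ is associated with at least one user. The set $\Phi_j^o$ of active BSs of tier $j$ is an independent thinning of $\Phi_j$ with retention probability $\mathcal A_j$. All channel vectors $\mathbf h$ have i.i.d. $\mathcal{CN}(0,1)$ entries. The channels $\mathbf h_{ze}$ from BSs $z$ to Eves $e$ are independent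 of each other and of everything else. The BS $z$ uses the beamforming vector $\mathbf w_z=\mathbf h_z^\dagger/\|\mathbf h_z\|$, where $\mathbf h_z$ is its channel to its served user and $\dagger$ is complex conjugation, and, for the artificial noise, a matrix $\mathbf W_z\in\mathbb C^{M_j\times(M_j-1)}$ such that the columns of $[\mathbf w_z\ \mathbf W_z]$ are an orthonormal basis. Fix a serving BS $b$ of tier $k$, present in addition to the BSs of the $\Phi_j$ and located at a fixed point. Let $r_{ze}$ be the distance from $z$ to $e$, and $N_0\ge 0$ the noise power. Eves are non-colluding and can cancel the interference from information signals, so that for $e\in\Phi_e$ $$\mathbf{SINR}_{e,k}=\frac{\phi_kP_k|\mathbf h_{be}^{\mathrm T}\mathbf w_b|^2r_{be}^{-\alpha}}{I_{be}+\sum_{j\in\mathcal K}\sum_{z\in\Phi_j^o}I_{ze}+N_0},\qquad I_{ze}=\frac{(1-\phi_j)P_j\|\mathbf h_{ze}^{\mathrm T}\mathbf W_z\|^2}{(M_j-1)\,r_{ze}^{\alpha}}\ \text{ for } z \text{ in tier } j .$$ For a target SINR $\beta_e>0$ the secrecy probability of tier $k$ is $$\mathcal P_{s,k}=\mathbb E\Big[\prod_{e\in\Phi_e}\mathbb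 P\{\mathbf{SINR}_{e,k}<\beta_e\mid\Phi_e,\Phi_1,\dots,\Phi_K\}\Big],$$ where each $\Phi_j$ in the condition includes the information on which of its BSs are active. \textbf{Theorem.} Let $\xi_j=\frac{\phi_j^{-1}-1}{M_j-1}$, $C_{\alpha,m}=\frac{\Gamma(m-1+2/\alpha)\,\Gamma(1-2/\alpha)}{\Gamma(m-1)}$ and $$\psi_k=\sum_{j\in\mathcal K}\mathcal A_j\lambda_jC_{\alpha,M_j}\Big(\xi_j\frac{\phi_j}{\phi_k}\frac{P_j}{P_k}\Big)^{\delta}.$$ Then $\mathcal P^L_{s,k}\le\mathcal P_{s,k}\le\mathcal P^U_{s,k}$, where $$\mathcal P^L_{s,k}=\exp\Big(-\frac{\pi\lambda_e}{(1+\xi_k\beta_e)^{M_k-1}}\int_0^\infty e^{-\frac{\beta_eN_0}{\phi_kP_k}r^{\alpha/2}-\pi\psi_k\beta_e^{\delta}r}\,dr\Big),$$ $$\mathcal P^U_{s,k}=1-\frac{\pi\lambda_e}{(1+\xi_k\beta_e)^{M_k-1}}\int_0^\infty e^{-\frac{\beta_eN_0}{\phi_kP_k}r^{\alpha/2}-\pi\psi_k\beta_e^{\delta}r-\pi\lambda_er}\,dr,$$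 and $\mathcal P^L_{s,k}=e^{-\infty}=0$ if its integral diverges (that is, if $N_0=\psi_k=0$). -/

import Mathlib

open MeasureTheory ProbabilityTheory Set
open scoped ENNReal NNReal Matrix ComplexConjugate

noncomputable section

/-- The plane `ℝ²` with its Euclidean distance and Lebesgue measure. -/
abbrev Plane : Type := EuclideanSpace ℝ (Fin 2)

/-! ### Poisson point processes and complex Gaussian vectors -/

/-- The number of points of the enumerated random configuration `X` that fall into `B`. -/
def pointCount {Ω E : Type*} (X : ℕ → Ω → E) (B : Set E) (ω : Ω) : ℕ∞ :=
  Set.encard {n | X n ω ∈ B}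

/-- `X` is an enumeration of (all the points of) a Poisson point process with intensity
measure `Λ`: counts in sets of finite intensity are Poisson, and counts in disjoint sets are
independent. As `X` has infinitely many points, this is for `Λ` of infinite total mass. -/
structure IsPoissonProcess {Ω E : Type*} [MeasurableSpace Ω] [MeasurableSpace E]
    (X : ℕ → Ω → E) (Λ : Measure E) (μ : Measure Ω) : Prop where
  measurable : ∀ n, Measurable (X n)
  count_law : ∀ B : Set E, MeasurableSet B → Λ B ≠ ∞ →
    HasLaw (pointCount X B) ((poissonMeasure (Λ B).toNNReal).map (fun n : ℕ => (n : ℕ∞))) μ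
  count_indep : ∀ (n : ℕ) (B : Fin n → Set E), (∀ i, MeasurableSet (B i)) →
    Pairwise (fun i j => Disjoint (B i) (B j)) →
    iIndepFun (fun i => pointCount X (B i)) μ

/-- The intensity measure of a homogeneous point process of density `ℓ` in the plane. -/
def homogeneous (ℓ : ℝ) : Measure Plane := ENNReal.ofReal ℓ • volume

/-- The circularly symmetric complex Gaussian law `CN(0,1)`: independent real and imaginary
parts, each with law `N(0, 1/2)`. -/
def cnLaw : Measure ℂ :=
  ((gaussianReal 0 (1 / 2)).prod (gaussianReal 0 (1 / 2))).map
    (fun p : ℝ × ℝ => (⟨p.1, p.2⟩ : ℂ))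

/-- The law of a vector with `m` i.i.d. `CN(0,1)` entries. -/
def cnVecLaw (m : ℕ) : Measure (Fin m → ℂ) := Measure.pi fun _ => cnLaw

/-! ### Deterministic parameters of the network -/

/-- The parameters of a `K`-tier network. -/
structure Network (K : ℕ) where
  /-- path-loss exponent -/
  α : ℝ
  /-- BS densities -/
  lam : Fin K → ℝ
  /-- transmit powers -/
  P : Fin K → ℝ
  /-- numbers of BS antennas -/
  M : Fin K → ℕ
  /-- information-signal power allocation ratios -/
  φ : Fin K → ℝ
  /-- density of UEs -/
  lamU : ℝ
  /-- density of Eves -/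
  lamE : ℝ
  /-- access threshold -/
  τ : ℝ
  /-- noise power -/
  N0 : ℝ
  two_lt_α : 2 < α
  lam_pos : ∀ j, 0 < lam j
  P_pos : ∀ j, 0 < P j
  two_le_M : ∀ j, 2 ≤ M j
  φ_pos : ∀ j, 0 < φ j
  φ_le_one : ∀ j, φ j ≤ 1
  lamU_pos : 0 < lamU
  lamE_pos : 0 < lamE
  τ_pos : 0 < τ
  N0_nonneg : 0 ≤ N0

namespace Network

variable {K : ℕ} (N : Network K)

/-- `δ = 2/α`. -/
def δ : ℝ := 2 / N.α

/-- `ξ_j = (φ_j⁻¹ - 1)/(M_j - 1)`. -/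
def ξ (j : Fin K) : ℝ := ((N.φ j)⁻¹ - 1) / ((N.M j : ℝ) - 1)

/-- `D_j`, the radius of the serving region of a BS of tier `j`. -/
def D (j : Fin K) : ℝ := (N.P j * N.M j / N.τ) ^ (1 / N.α)

/-- The truncated average received signal power from a BS of tier `j` at distance `r`. -/
def arsp (j : Fin K) (r : ℝ) : ℝ :=
  open scoped Classical in if r ≤ N.D j then N.P j * N.M j * r ^ (-N.α) else 0

/-- `C_{α,m} = Γ(m-1+2/α) Γ(1-2/α) / Γ(m-1)`. -/
def C (m : ℕ) : ℝ :=
  Real.Gamma ((m : ℝ) - 1 + 2 / N.α) * Real.Gamma (1 - 2 / N.α) / Real.Gamma ((m : ℝ) - 1)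

/-- `ψ_k`, for BS activation probabilities `A`. -/
def ψ (A : Fin K → ℝ) (k : Fin K) : ℝ :=
  ∑ j, A j * N.lam j * N.C (N.M j) *
    (N.ξ j * (N.φ j / N.φ k) * (N.P j / N.P k)) ^ N.δ

/-- The exponential integrand of the lower bound. -/
def lowerIntegrand (A : Fin K → ℝ) (k : Fin K) (β r : ℝ) : ℝ :=
  Real.exp (-(β * N.N0 / (N.φ k * N.P k)) * r ^ (N.α / 2) - Real.pi * N.ψ A k * β ^ N.δ * r)

/-- The lower bound. Its integral diverges when there is neither noise nor artificial noise
from other BSs; the bound is then `e^{-∞} = 0`. -/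
def lowerBound (A : Fin K → ℝ) (k : Fin K) (β : ℝ) : ℝ :=
  open scoped Classical in
  if IntegrableOn (N.lowerIntegrand A k β) (Ioi 0) then
    Real.exp (-(Real.pi * N.lamE / (1 + N.ξ k * β) ^ (N.M k - 1) *
      ∫ r in Ioi (0 : ℝ), N.lowerIntegrand A k β r))
  else 0

/-- The upper bound. -/
def upperBound (A : Fin K → ℝ) (k : Fin K) (β : ℝ) : ℝ :=
  1 - Real.pi * N.lamE / (1 + N.ξ k * β) ^ (N.M k - 1) *
    ∫ r in Ioi (0 : ℝ),
      Real.exp (-(β * N.N0 / (N.φ k * N.P k)) * r ^ (N.α / 2)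
        - Real.pi * N.ψ A k * β ^ N.δ * r - Real.pi * N.lamE * r)

end Network

/-! ### Node locations -/

/-- The point processes of the network: the BSs of each tier, the UEs, the Eves. -/
inductive Node (K : ℕ) : Type
  | bs (j : Fin K)
  | ue
  | eve

/-- The density of each of the point processes. -/
def Network.density {K : ℕ} (N : Network K) : Node K → ℝ
  | .bs j => N.lam j
  | .ue => N.lamU
  | .eve => N.lamE

/-- Independent homogeneous Poisson processes of BSs (tier by tier), UEs and Eves. -/
structure Locations {K : ℕ} (N : Network K) {Ω : Type*} [MeasurableSpace Ω] (μ : Measure Ω) where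
  /-- the location of the `n`-th point of a process -/
  pt : Node K → ℕ → Ω → Plane
  poisson : ∀ s, IsPoissonProcess (pt s) (homogeneous (N.density s)) μ
  indep : iIndepFun (fun s ω n => pt s n ω) μ

namespace Locations

variable {K : ℕ} {N : Network K} {Ω : Type*} [MeasurableSpace Ω] {μ : Measure Ω}

/-- A typical BS of tier `k`, placed at the origin in addition to the BSs of the network, is the
BS with the largest truncated ARSP (and this is not zero) for at least one UE. -/
def ServesSomeUser (L : Locations N μ) (k : Fin K) (ω : Ω) : Prop :=
  ∃ u : ℕ, 0 < N.arsp k ‖L.pt .ue u ω‖ ∧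
    ∀ (j : Fin K) (n : ℕ),
      N.arsp j (dist (L.pt .ue u ω) (L.pt (.bs j) n ω)) < N.arsp k ‖L.pt .ue u ω‖

/-- The BS activation probability `A_k`: the probability that a (typical) BS of tier `k`
associates with at least one UE. -/
def activationProb (L : Locations N μ) (k : Fin K) : ℝ := μ.real {ω | L.ServesSomeUser k ω}

end Locations

/-! ### Transmission -/

/-- The BSs seen by an Eve when the serving BS is in tier `k`: the serving BS, and the `n`-th
point of the BS process of tier `j`, for all `j` and `n`. -/
inductive Tx {K : ℕ} (k : Fin K) : Type
  | serving
  | other (j : Fin K) (n : ℕ)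

/-- The tier of a BS. -/
def Tx.tier {K : ℕ} {k : Fin K} : Tx k → Fin K
  | .serving => k
  | .other j _ => j

/-- The Euclidean norm of a complex vector. -/
def cnorm {m : ℕ} (v : Fin m → ℂ) : ℝ := Real.sqrt (∑ i, ‖v i‖ ^ 2)

/-- The beamforming vector `h† / ‖h‖` for a served UE with channel `h`. -/
def beam {m : ℕ} (h : Fin m → ℂ) : Fin m → ℂ := fun i => conj (h i) / (cnorm h : ℂ)

/-- Artificial-noise-aided transmission in the network to a UE served by a tier-`k` BS at `b`. -/
structure SecureTransmission {K : ℕ} (N : Network K) (k : Fin K) (b : Plane)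
    {Ω : Type*} [MeasurableSpace Ω] (μ : Measure Ω) extends Locations N μ where
  /-- whether a BS of the BS processes is active -/
  active : Fin K → ℕ → Ω → Bool
  /-- the channel from a BS to the UE that it serves -/
  hUser : (z : Tx k) → Ω → (Fin (N.M z.tier) → ℂ)
  /-- the weight matrix of the artificial noise of a BS -/
  W : (z : Tx k) → Ω → Matrix (Fin (N.M z.tier)) (Fin (N.M z.tier - 1)) ℂ
  /-- the channel from a BS to the `e`-th Eve -/
  hEve : (z : Tx k) → (e : ℕ) → Ω → (Fin (N.M z.tier) → ℂ)
  active_measurable : ∀ j n, Measurable (active j n)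
  hUser_measurable : ∀ z, Measurable (hUser z)
  W_measurable : ∀ z i l, Measurable fun ω => W z ω i l
  hEve_measurable : ∀ z e, Measurable (hEve z e)
  /-- the active BSs form an independent thinning of the BSs, with the BS activation
  probabilities as retention probabilities -/
  active_prob : ∀ j n, μ {ω | active j n ω = true} = ENNReal.ofReal (toLocations.activationProb j)
  active_iIndep : iIndepFun (fun p : Fin K × ℕ => active p.1 p.2) μ
  active_indep : IndepFun (fun ω j n => active j n ω) (fun ω s n => toLocations.pt s n ω) μ
  /-- Rayleigh fading to the served UEs, independent of locations and activity -/
  hUser_law : ∀ z, HasLaw (hUser z) (cnVecLaw (N.M z.tier)) μ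
  hUser_iIndep : iIndepFun hUser μ
  hUser_indep : IndepFun (fun ω z => hUser z ω)
    (fun ω => (fun s n => toLocations.pt s n ω, fun j n => active j n ω)) μ
  /-- the columns of `[w W]` are orthonormal -/
  W_orthonormal : ∀ z, ∀ᵐ ω ∂μ,
    (W z ω)ᴴ * W z ω = 1 ∧ (W z ω)ᴴ *ᵥ beam (hUser z ω) = 0
  /-- Rayleigh fading to the Eves, independent between links and of everything else -/
  hEve_law : ∀ z e, HasLaw (hEve z e) (cnVecLaw (N.M z.tier)) μ
  hEve_iIndep : iIndepFun (fun p : Tx k × ℕ => hEve p.1 p.2) μ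
  hEve_indep : IndepFun (fun ω z e => hEve z e ω)
    (fun ω => ((fun s n => toLocations.pt s n ω, fun j n => active j n ω),
      (fun z => hUser z ω, fun z i l => W z ω i l))) μ

namespace SecureTransmission

variable {K : ℕ} {N : Network K} {k : Fin K} {b : Plane} {Ω : Type*} [MeasurableSpace Ω]
  {μ : Measure Ω} (S : SecureTransmission N k b μ)

/-- The location of a BS. -/
def loc : Tx k → Ω → Plane
  | .serving, _ => b
  | .other j n, ω => S.pt (.bs j) n ω

/-- The distance `r_{ze}` from the BS `z` to the `e`-th Eve. -/
def r (z : Tx k) (e : ℕ) (ω : Ω) : ℝ := dist (S.loc z ω) (S.pt .eve e ω)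

/-- The power of the information signal of the serving BS at the `e`-th Eve. -/
def signal (e : ℕ) (ω : Ω) : ℝ :=
  N.φ k * N.P k * ‖S.hEve .serving e ω ⬝ᵥ beam (S.hUser .serving ω)‖ ^ 2 *
    S.r .serving e ω ^ (-N.α)

/-- The power of the artificial noise of the BS `z` at the `e`-th Eve. -/
def artificialNoise (z : Tx k) (e : ℕ) (ω : Ω) : ℝ :=
  (1 - N.φ z.tier) * N.P z.tier * cnorm (S.hEve z e ω ᵥ* S.W z ω) ^ 2 /
    (((N.M z.tier : ℝ) - 1) * S.r z e ω ^ N.α)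

/-- The SINR of the `e`-th Eve, as an extended nonnegative number (a positive signal without
any noise has SINR `∞`). -/
def sinr (e : ℕ) (ω : Ω) : ℝ≥0∞ :=
  ENNReal.ofReal (S.signal e ω) /
    (ENNReal.ofReal (S.artificialNoise .serving e ω)
      + ∑ j, ∑' n, (if S.active j n ω = true then
          ENNReal.ofReal (S.artificialNoise (.other j n) e ω) else 0)
      + ENNReal.ofReal N.N0)

/-- The information on the locations of the Eves and on the locations and activity of the BSs. -/
abbrev sites : MeasurableSpace Ω :=
  MeasurableSpace.comap
    (fun ω => (fun e => S.pt .eve e ω, (fun j n => S.pt (.bs j) n ω, fun j n => S.active j n ω)))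
    inferInstance

/-- The secrecy probability: the expectation, over the BSs and the Eves, of the product over the
Eves of the conditional probabilities that their SINR is less than `β`. -/
def secrecyProb (β : ℝ) : ℝ :=
  ∫ ω, ∏' e : ℕ, (μ⟦{ω' | S.sinr e ω' < ENNReal.ofReal β} | S.sites⟧) ω ∂μ

end SecureTransmission

end

/-!
The proof conditions on the positions and on the activity of the BSs, and then averages over the
Eves and over the BSs.

*One Eve.* The beam `w_b` of the serving BS is independent of the channel `h_be`, so `|h_beᵀ w_b|²`
is standard exponential and independent of the interference power `‖h_beᵀ W_b‖²` of the same BS,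
which is a sum of `M_k - 1` independent standard exponentials; the artificial noise of another BS
of tier `j` is likewise a sum of `M_j - 1` standard exponentials, independent over the BSs. Both
come from the invariance of complex Gaussian vectors under unitary matrices, applied conditionally
on the beamforming. Since the tail of the signal is exponential, the conditional probability that
the Eve reaches the target SINR is the Laplace transform of the noise plus interference, which is
the explicit product `Network.interceptProb` over the active BSs. So the secrecy probability is
the mean of `∏ e, (1 - p (x_e))`, where `p` is this function of the position
(`SecureTransmission.secrecyProb_eq`).

*The Eves.* They are independent of the BSs and form a Poisson process, so its generating
functional (`IsPoissonProcess.lintegral_infProd_one_sub`) turns the secrecy probability into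
`E[exp (-V)]`, where `V` is the integral of `p` against the intensity of the Eves
(`SecureTransmission.lintegral_infProd_intercept`).

*The BSs.* The generating functional of the thinned Poisson processes and a Gamma integral give
`E[p x]` as `(1 + ξ_k β)^(1 - M_k)` times the exponential in the integrals of the theorem, with
`r = |x - b|²` (`SecureTransmission.lintegral_interceptProb`).

*The bounds.* Jensen's inequality `E[exp (-V)] ≥ exp (-E[V])` is the lower bound. The upper bound
says that the secrecy probability is at most the probability that the Eve nearest to `b` is not
successful. Without Palm calculus, it is the deterministic inequality
`exp (-ν(E)) + ∫ exp (-h) dν ≤ 1` (`expNeg_add_lintegral_expNeg_le_one`), valid for a measure `ν`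
with `ν {h ≤ t} ≤ t` for all `t`: here `ν` has density `p` with respect to the intensity of the
Eves, and `h x = π λ_e |x - b|²`.
-/

noncomputable section

open Filter Topology

/-! ### The function `e^{-x}` on `[0, ∞]` and infinite products of numbers in `[0, 1]` -/

/-- The function `x ↦ e^{-x}` on `[0, ∞]`, with value `0` at `∞`. -/
def expNeg (x : ℝ≥0∞) : ℝ≥0∞ := EReal.exp (-(x : EReal))

lemma expNeg_eq_inv (x : ℝ≥0∞) : expNeg x = (EReal.exp x)⁻¹ := EReal.exp_neg _

@[simp] lemma expNeg_zero : expNeg 0 = 1 := by simp [expNeg]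

@[simp] lemma expNeg_top : expNeg ∞ = 0 := by simp [expNeg]

lemma expNeg_ofReal {x : ℝ} (hx : 0 ≤ x) :
    expNeg (ENNReal.ofReal x) = ENNReal.ofReal (Real.exp (-x)) := by
  rw [expNeg, EReal.coe_ennreal_ofReal, max_eq_left hx, ← EReal.coe_neg, EReal.exp_coe]

lemma expNeg_add (x y : ℝ≥0∞) : expNeg (x + y) = expNeg x * expNeg y := by
  have h (x : ℝ≥0∞) : EReal.exp x ≠ 0 := by simp
  rw [expNeg_eq_inv, expNeg_eq_inv, expNeg_eq_inv, EReal.coe_ennreal_add, EReal.exp_add,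
    ENNReal.mul_inv (Or.inl (h x)) (Or.inr (h y))]

lemma expNeg_sum {ι : Type*} (s : Finset ι) (f : ι → ℝ≥0∞) :
    expNeg (∑ i ∈ s, f i) = ∏ i ∈ s, expNeg (f i) := by
  classical
  induction s using Finset.induction_on with
  | empty => simp
  | insert a s ha ih => rw [Finset.sum_insert ha, Finset.prod_insert ha, expNeg_add, ih]

lemma expNeg_antitone : Antitone expNeg := fun x y h => by
  rw [expNeg, expNeg, EReal.exp_le_exp_iff, EReal.neg_le_neg_iff]
  exact_mod_cast h

lemma expNeg_le_one (x : ℝ≥0∞) : expNeg x ≤ 1 := by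
  simpa using expNeg_antitone (zero_le (a := x))

lemma expNeg_ne_top (x : ℝ≥0∞) : expNeg x ≠ ∞ :=
  ((expNeg_le_one x).trans_lt ENNReal.one_lt_top).ne

lemma continuous_expNeg : Continuous expNeg :=
  ENNReal.continuous_exp.comp (continuous_neg.comp continuous_coe_ennreal_ereal)

@[fun_prop]
lemma measurable_expNeg : Measurable expNeg := continuous_expNeg.measurable

/-- The infinite product of a sequence of numbers in `[0, 1]`, as the infimum of its partial
products. -/
def infProd (u : ℕ → ℝ≥0∞) : ℝ≥0∞ := ⨅ N, ∏ n ∈ Finset.range N, u n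

lemma antitone_prod_range {u : ℕ → ℝ≥0∞} (hu : ∀ n, u n ≤ 1) :
    Antitone fun N => ∏ n ∈ Finset.range N, u n := by
  refine antitone_nat_of_succ_le fun N => ?_
  rw [Finset.prod_range_succ]
  exact mul_le_of_le_one_right zero_le (hu N)

lemma tendsto_infProd {u : ℕ → ℝ≥0∞} (hu : ∀ n, u n ≤ 1) :
    Tendsto (fun N => ∏ n ∈ Finset.range N, u n) atTop (𝓝 (infProd u)) :=
  tendsto_atTop_iInf (antitone_prod_range hu)

lemma infProd_le_one (u : ℕ → ℝ≥0∞) : infProd u ≤ 1 :=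
  (iInf_le _ 0).trans (by simp)

lemma infProd_ne_top (u : ℕ → ℝ≥0∞) : infProd u ≠ ∞ :=
  ((infProd_le_one u).trans_lt ENNReal.one_lt_top).ne

@[fun_prop]
lemma Measurable.infProd {α : Type*} [MeasurableSpace α] {u : ℕ → α → ℝ≥0∞}
    (hu : ∀ n, Measurable (u n)) : Measurable fun a => infProd fun n => u n a := by
  unfold _root_.infProd
  fun_prop

lemma infProd_expNeg (u : ℕ → ℝ≥0∞) : infProd (fun n => expNeg (u n)) = expNeg (∑' n, u n) := by
  refine tendsto_nhds_unique (tendsto_infProd fun n => expNeg_le_one _) ?_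
  simp_rw [← expNeg_sum]
  exact (continuous_expNeg.tendsto _).comp (ENNReal.tendsto_nat_tsum u)

lemma prod_infProd {ι : Type*} [Fintype ι] {u : ι → ℕ → ℝ≥0∞} (hu : ∀ i n, u i n ≤ 1) :
    ∏ i, infProd (u i) = ⨅ N, ∏ i, ∏ n ∈ Finset.range N, u i n := by
  refine tendsto_nhds_unique (ENNReal.tendsto_finsetProd_of_ne_top _
    (fun i _ => tendsto_infProd (hu i)) fun i _ => infProd_ne_top _) (tendsto_atTop_iInf ?_)
  exact fun N N' h => Finset.prod_le_prod' fun i _ => antitone_prod_range (hu i) h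

/-- The unconditional product of real numbers in `[0, 1]` agrees with `infProd`. -/
lemma tprod_toReal {u : ℕ → ℝ≥0∞} (hu : ∀ n, u n ≤ 1) :
    ∏' n, (u n).toReal = (infProd u).toReal := by
  have hle (n) : (u n).toReal ≤ 1 := by
    simpa using ENNReal.toReal_mono ENNReal.one_ne_top (hu n)
  have h : HasProd (fun n => (u n).toReal) (⨅ s : Finset ℕ, ∏ n ∈ s, (u n).toReal) := by
    refine tendsto_atTop_ciInf (fun s t hst => ?_)
      ⟨0, by rintro _ ⟨s, rfl⟩; exact Finset.prod_nonneg fun _ _ => ENNReal.toReal_nonneg⟩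
    change ∏ n ∈ t, (u n).toReal ≤ ∏ n ∈ s, (u n).toReal
    rw [← Finset.prod_sdiff hst]
    exact mul_le_of_le_one_left (Finset.prod_nonneg fun _ _ => ENNReal.toReal_nonneg)
      (Finset.prod_le_one (fun _ _ => ENNReal.toReal_nonneg) fun _ _ => hle _)
  rw [h.tprod_eq]
  refine tendsto_nhds_unique h.tendsto_prod_nat ?_
  simp_rw [← ENNReal.toReal_prod]
  exact (ENNReal.tendsto_toReal (infProd_ne_top u)).comp (tendsto_infProd hu)

/-! ### Expectations of functions of independent variables -/

section Independence

variable {Ω : Type*} [MeasurableSpace Ω] {μ : Measure Ω} [IsProbabilityMeasure μ]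

/-- The expectation of a function of two independent variables may be computed by first
averaging over an independent copy of one of them. -/
lemma ProbabilityTheory.IndepFun.lintegral_comp_eq {α β : Type*} [MeasurableSpace α]
    [MeasurableSpace β] {X : Ω → α} {Y : Ω → β} (h : IndepFun X Y μ) (hX : Measurable X)
    (hY : Measurable Y) {F : α → β → ℝ≥0∞} (hF : Measurable fun p : α × β => F p.1 p.2) :
    ∫⁻ ω, F (X ω) (Y ω) ∂μ = ∫⁻ ω, ∫⁻ ω', F (X ω') (Y ω) ∂μ ∂μ := by
  have := Measure.isProbabilityMeasure_map (μ := μ) hX.aemeasurable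
  have := Measure.isProbabilityMeasure_map (μ := μ) hY.aemeasurable
  rw [← lintegral_map (f := fun p : α × β => F p.1 p.2) hF (hX.prodMk hY),
    (indepFun_iff_map_prod_eq_prod_map_map hX.aemeasurable hY.aemeasurable).1 h,
    lintegral_prod_symm' _ hF, lintegral_map hF.lintegral_prod_left' hY]
  refine lintegral_congr fun ω => ?_
  rw [lintegral_map (by fun_prop) hX]

/-- Independent families of `[0, 1]`-valued variables: the expectation of the infinite product
is the product of the expectations. -/
lemma lintegral_prod_infProd {ι : Type*} [Fintype ι] {Y : ι × ℕ → Ω → ℝ≥0∞}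
    (hY : ∀ p, Measurable (Y p)) (hY1 : ∀ p ω, Y p ω ≤ 1) (hi : iIndepFun Y μ) :
    ∫⁻ ω, ∏ i, infProd (fun n => Y (i, n) ω) ∂μ
      = ∏ i, infProd (fun n => ∫⁻ ω, Y (i, n) ω ∂μ) := by
  have h1 (p) : ∫⁻ ω, Y p ω ∂μ ≤ 1 := by
    simpa using lintegral_mono (μ := μ) (hY1 p)
  simp_rw [prod_infProd fun i n => hY1 (i, n) _]
  rw [prod_infProd fun i n => h1 (i, n), lintegral_iInf]
  · refine iInf_congr fun N => ?_
    have h (f : ι → ℕ → ℝ≥0∞) : ∏ i, ∏ n ∈ Finset.range N, f i n =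
        ∏ p ∈ Finset.univ ×ˢ Finset.range N, f p.1 p.2 := (Finset.prod_product' _ _ f).symm
    simp_rw [h]
    exact lintegral_prod_eq_prod_lintegral_of_indepFun _ _ hi hY
  · fun_prop
  · exact fun N N' h ω => Finset.prod_le_prod' fun i _ => antitone_prod_range (fun n => hY1 _ ω) h
  · simp

end Independence

/-! ### The generating functional of a Poisson point process -/

lemma lintegral_pow_poissonMeasure (r : ℝ≥0) {s : ℝ≥0∞} (hs : s ≤ 1) :
    ∫⁻ n, s ^ n ∂poissonMeasure r = expNeg ((1 - s) * r) := by
  lift s to ℝ≥0 using (hs.trans_lt ENNReal.one_lt_top).ne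
  have hs' : (s : ℝ) ≤ 1 := by exact_mod_cast hs
  have h : HasSum (fun n : ℕ => Real.exp (-r) * (r * s : ℝ) ^ n / (n.factorial : ℝ))
      (Real.exp (-((1 - s) * r))) := by
    have := (NormedSpace.expSeries_div_hasSum_exp (𝔸 := ℝ) (r * s : ℝ)).mul_left
      (Real.exp (-r))
    rw [← Real.exp_eq_exp_ℝ, ← Real.exp_add] at this
    rw [show -((1 - s) * r : ℝ) = -r + r * s by ring]
    simpa only [mul_div_assoc] using this
  rw [poissonMeasure, lintegral_sum_measure]
  simp_rw [lintegral_smul_measure, lintegral_dirac]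
  have h1 : (1 - (s : ℝ≥0∞)) * r = ENNReal.ofReal ((1 - s) * r) := by
    rw [ENNReal.ofReal_mul (by linarith), ENNReal.ofReal_sub _ s.coe_nonneg]
    simp
  rw [h1, expNeg_ofReal (mul_nonneg (by linarith) r.coe_nonneg), ← h.tsum_eq,
    ENNReal.ofReal_tsum_of_nonneg (fun n => by positivity) h.summable]
  refine tsum_congr fun n => ?_
  rw [← ENNReal.ofReal_coe_nnreal, ← ENNReal.ofReal_pow s.coe_nonneg, smul_eq_mul,
    ← ENNReal.ofReal_mul (by positivity)]
  congr 1
  rw [mul_pow]; ring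

section

variable {Ω : Type*} [MeasurableSpace Ω] {μ : Measure Ω}

lemma lintegral_prod_eq_prod_lintegral_of_iIndepFun₀ {ι : Type*} [Fintype ι]
    {Y : ι → Ω → ℝ≥0∞} (hi : iIndepFun Y μ) (hY : ∀ i, AEMeasurable (Y i) μ) :
    ∫⁻ ω, ∏ i, Y i ω ∂μ = ∏ i, ∫⁻ ω, Y i ω ∂μ := by
  have h := lintegral_prod_eq_prod_lintegral_of_indepFun Finset.univ (fun i => (hY i).mk)
    ((iIndepFun_congr fun i => (hY i).ae_eq_mk).1 hi) fun i => (hY i).measurable_mk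
  rw [lintegral_congr_ae (g := fun ω => ∏ i, (hY i).mk (Y i) ω), h]
  · exact Finset.prod_congr rfl fun i _ => lintegral_congr_ae (hY i).ae_eq_mk.symm
  · filter_upwards [ae_all_iff.2 fun i => (hY i).ae_eq_mk] with ω hω
    exact Finset.prod_congr rfl fun i _ => hω i

variable {E : Type*} [MeasurableSpace E] {X : ℕ → Ω → E} {Λ : Measure E}

lemma IsPoissonProcess.lintegral_pow_pointCount (hX : IsPoissonProcess X Λ μ) {B : Set E}
    (hB : MeasurableSet B) (hΛ : Λ B ≠ ∞) {s : ℝ≥0∞} (hs : s ≤ 1) :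
    ∫⁻ ω, s ^ (pointCount X B ω).toNat ∂μ = expNeg ((1 - s) * Λ B) := by
  have h := hX.count_law B hB hΛ
  have hm : Measurable fun k : ℕ∞ => s ^ k.toNat := Measurable.of_discrete
  rw [← lintegral_map' (f := fun k : ℕ∞ => s ^ k.toNat) hm.aemeasurable h.aemeasurable,
    h.map_eq, lintegral_map hm Measurable.of_discrete]
  simp_rw [ENat.toNat_natCast]
  rw [lintegral_pow_poissonMeasure _ hs, ENNReal.coe_toNNReal hΛ]

lemma IsPoissonProcess.ae_pointCount_ne_top (hX : IsPoissonProcess X Λ μ) {B : Set E}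
    (hB : MeasurableSet B) (hΛ : Λ B ≠ ∞) : ∀ᵐ ω ∂μ, pointCount X B ω ≠ ⊤ := by
  have h := hX.count_law B hB hΛ
  refine ae_of_ae_map h.aemeasurable (p := fun k => k ≠ ⊤) ?_
  rw [h.map_eq, ae_map_iff Measurable.of_discrete.aemeasurable (by measurability)]
  simp

/-- Almost surely, no point of a Poisson process lies in a given null set. -/
lemma IsPoissonProcess.ae_notMem (hX : IsPoissonProcess X Λ μ) {B : Set E}
    (hB : MeasurableSet B) (hΛ : Λ B = 0) : ∀ᵐ ω ∂μ, ∀ n, X n ω ∉ B := by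
  have h := hX.count_law B hB (by simp [hΛ])
  have h0 : ∀ᵐ ω ∂μ, pointCount X B ω = 0 := by
    refine ae_of_ae_map h.aemeasurable (p := fun k => k = 0) ?_
    rw [h.map_eq, ae_map_iff Measurable.of_discrete.aemeasurable (by measurability), hΛ,
      ae_iff, poissonMeasure]
    have : {a : ℕ | ¬ (a : ℕ∞) = 0} = {n | n ≠ 0} := by ext; simp
    rw [this, Measure.sum_apply _ (by measurability)]
    simp only [ENNReal.tsum_eq_zero]
    intro n
    rcases eq_or_ne n 0 with rfl | hn <;> simp [*]
  filter_upwards [h0] with ω hω n hn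
  have := Set.encard_eq_zero.1 hω
  exact (this ▸ hn : n ∈ (∅ : Set ℕ))

/-- A sequence with finitely many values, each nonzero one taken finitely often: the product of
the `1 - y n` counts how often each value is taken. -/
lemma infProd_one_sub_eq_prod_pow {y : ℕ → ℝ≥0∞} {s : Finset ℝ≥0∞} (hs : ∀ n, y n ∈ s)
    (hf : ∀ c ∈ s, c ≠ 0 → {n | y n = c}.encard ≠ ⊤) :
    infProd (fun n => 1 - y n) = ∏ c ∈ s, (1 - c) ^ {n | y n = c}.encard.toNat := by
  classical
  refine tendsto_nhds_unique (tendsto_infProd fun n => tsub_le_self) ?_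
  have h (N : ℕ) : ∏ n ∈ Finset.range N, (1 - y n)
      = ∏ c ∈ s, (1 - c) ^ ((Finset.range N).filter fun n => y n = c).card := by
    rw [← Finset.prod_fiberwise_of_maps_to (g := y) (t := s) fun n _ => hs n]
    refine Finset.prod_congr rfl fun c _ => ?_
    rw [← Finset.prod_const]
    exact Finset.prod_congr rfl fun n hn => by rw [(Finset.mem_filter.1 hn).2]
  simp_rw [h]
  refine ENNReal.tendsto_finsetProd_of_ne_top _ (fun c hc => ?_) fun c _ => ?_
  · rcases eq_or_ne c 0 with rfl | h0
    · simp
    have hfin : {n | y n = c}.Finite := Set.encard_ne_top_iff.1 (hf c hc h0)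
    obtain ⟨b, hb⟩ := hfin.bddAbove
    refine tendsto_const_nhds.congr' ?_
    filter_upwards [eventually_gt_atTop b] with N hN
    rw [← Set.ncard_def, Set.ncard_eq_toFinset_card _ hfin]
    congr 2
    ext n
    simp only [Finite.mem_toFinset, mem_ofPred_eq, Finset.mem_filter, Finset.mem_range]
    exact ⟨fun h => ⟨(hb h).trans_lt hN, h⟩, fun h => h.2⟩
  · exact ((pow_le_one' tsub_le_self _).trans_lt ENNReal.one_lt_top).ne

/-- The generating functional at a simple function: the numbers of points on its level sets are
independent Poisson variables. -/
lemma IsPoissonProcess.lintegral_infProd_simpleFunc [IsProbabilityMeasure μ]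
    (hX : IsPoissonProcess X Λ μ) (g : SimpleFunc E ℝ≥0∞) (hg1 : ∀ x, g x ≤ 1)
    (hg : ∀ c ≠ 0, Λ (g ⁻¹' {c}) ≠ ∞) :
    ∫⁻ ω, infProd (fun n => 1 - g (X n ω)) ∂μ = expNeg (∫⁻ x, g x ∂Λ) := by
  have hmem (x : E) : g x ∈ g.range := SimpleFunc.mem_range_self g x
  have hae : ∀ᵐ ω ∂μ, infProd (fun n => 1 - g (X n ω))
      = ∏ c ∈ g.range, (1 - c) ^ (pointCount X (g ⁻¹' {c}) ω).toNat := by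
    have hall : ∀ᵐ ω ∂μ, ∀ c ∈ g.range, c ≠ 0 → pointCount X (g ⁻¹' {c}) ω ≠ ⊤ := by
      refine (ae_ball_iff g.range.countable_toSet).2 fun c _ => ?_
      rcases eq_or_ne c 0 with rfl | h0
      · simp
      · filter_upwards [hX.ae_pointCount_ne_top (g.measurableSet_preimage {c}) (hg c h0)]
          with ω hω _ using hω
    filter_upwards [hall] with ω hω
    exact infProd_one_sub_eq_prod_pow (fun n => hmem _) hω
  have hs : ∀ c ∈ g.range, c ≤ 1 := fun c hc => by
    obtain ⟨x, rfl⟩ := SimpleFunc.mem_range.1 hc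
    exact hg1 x
  set e := g.range.equivFin
  have hind := (hX.count_indep _ (fun i => g ⁻¹' {((e.symm i : g.range) : ℝ≥0∞)})
    (fun i => g.measurableSet_preimage _) fun i j hij => by
      refine Disjoint.preimage _ (Set.disjoint_singleton.2 fun h => hij ?_)
      exact e.symm.injective (Subtype.ext h)).comp
    (fun i k => (1 - ((e.symm i : g.range) : ℝ≥0∞)) ^ k.toNat) fun i => Measurable.of_discrete
  have hsum : ∫⁻ x, g x ∂Λ = ∑ i, ((e.symm i : g.range) : ℝ≥0∞) *
      Λ (g ⁻¹' {((e.symm i : g.range) : ℝ≥0∞)}) := by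
    rw [SimpleFunc.lintegral_eq_lintegral, SimpleFunc.lintegral,
      ← Finset.sum_coe_sort, ← e.symm.sum_comp]
  rw [lintegral_congr_ae hae, hsum, expNeg_sum]
  simp_rw [← Finset.prod_coe_sort g.range, ← e.symm.prod_comp]
  refine (lintegral_prod_eq_prod_lintegral_of_iIndepFun₀ hind fun i => ?_).trans
    (Finset.prod_congr rfl fun i _ => ?_)
  · by_cases h0 : ((e.symm i : g.range) : ℝ≥0∞) = 0
    · simp only [Function.comp_def, h0, tsub_zero, one_pow]
      exact aemeasurable_const
    · exact Measurable.of_discrete.comp_aemeasurable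
        (hX.count_law _ (g.measurableSet_preimage _) (hg _ h0)).aemeasurable
  · by_cases h0 : ((e.symm i : g.range) : ℝ≥0∞) = 0
    · simp [h0]
    · refine (hX.lintegral_pow_pointCount (g.measurableSet_preimage _) (hg _ h0)
        tsub_le_self).trans ?_
      rw [ENNReal.sub_sub_cancel ENNReal.one_ne_top (hs _ (e.symm i).2)]

/-- The generating functional of a Poisson point process. -/
theorem IsPoissonProcess.lintegral_infProd_one_sub [IsProbabilityMeasure μ] [SigmaFinite Λ]
    (hX : IsPoissonProcess X Λ μ) {g : E → ℝ≥0∞} (hg : Measurable g) (hg1 : ∀ x, g x ≤ 1) :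
    ∫⁻ ω, infProd (fun n => 1 - g (X n ω)) ∂μ = expNeg (∫⁻ x, g x ∂Λ) := by
  -- simple functions of finite support that increase to `g`
  set G : ℕ → SimpleFunc E ℝ≥0∞ := fun k =>
    (SimpleFunc.eapprox g k).restrict (spanningSets Λ k)
  have hGval (k x) : G k x = (spanningSets Λ k).indicator (SimpleFunc.eapprox g k) x :=
    SimpleFunc.restrict_apply _ (measurableSet_spanningSets Λ k) x
  have hGmono (x) : Monotone fun k => G k x := fun k l hkl => by
    simp_rw [hGval]
    exact (indicator_le_indicator (SimpleFunc.monotone_eapprox g hkl x)).trans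
      (indicator_le_indicator_of_subset (monotone_spanningSets Λ hkl) (fun _ => zero_le) x)
  have hGlim (x) : Tendsto (fun k => G k x) atTop (𝓝 (g x)) := by
    have h1 := SimpleFunc.tendsto_eapprox hg x
    refine h1.congr' ?_
    filter_upwards [eventually_ge_atTop (spanningSetsIndex Λ x)] with k hk
    rw [hGval, indicator_of_mem (mem_spanningSets_of_index_le Λ x hk)]
  have hGle (k x) : G k x ≤ g x := (hGmono x).ge_of_tendsto (hGlim x) k
  have hGint : Tendsto (fun k => expNeg (∫⁻ x, G k x ∂Λ)) atTop (𝓝 (expNeg (∫⁻ x, g x ∂Λ))) :=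
    (continuous_expNeg.tendsto _).comp (lintegral_tendsto_of_tendsto_of_monotone
      (fun k => (G k).measurable.aemeasurable) (.of_forall hGmono) (.of_forall hGlim))
  have hanti (ω) (N : ℕ) : Antitone fun k => ∏ n ∈ Finset.range N, (1 - G k (X n ω)) :=
    fun k l hkl => Finset.prod_le_prod' fun n _ => tsub_le_tsub_left (hGmono _ hkl) _
  have hinf (ω) : infProd (fun n => 1 - g (X n ω))
      = ⨅ k, infProd fun n => 1 - G k (X n ω) := by
    unfold infProd
    rw [iInf_comm]
    refine iInf_congr fun N => tendsto_nhds_unique ?_ (tendsto_atTop_iInf (hanti ω N))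
    refine ENNReal.tendsto_finsetProd_of_ne_top _ (fun n _ => ?_) fun n _ => ?_
    · exact ENNReal.Tendsto.sub tendsto_const_nhds (hGlim _) (Or.inl ENNReal.one_ne_top)
    · exact (tsub_le_self.trans_lt ENNReal.one_lt_top).ne
  simp_rw [hinf]
  rw [lintegral_iInf]
  · have h (k) : ∫⁻ ω, infProd (fun n => 1 - G k (X n ω)) ∂μ = expNeg (∫⁻ x, G k x ∂Λ) := by
      refine hX.lintegral_infProd_simpleFunc (G k) (fun x => (hGle k x).trans (hg1 x)) ?_
      intro c hc
      refine ((measure_mono fun x hx => ?_).trans_lt (measure_spanningSets_lt_top Λ k)).ne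
      by_contra hxs
      exact hc (by rw [← (hx : G k x = c), hGval, indicator_of_notMem hxs])
    simp_rw [h]
    exact tendsto_nhds_unique (tendsto_atTop_iInf fun k l hkl =>
      expNeg_antitone (lintegral_mono fun x => hGmono x hkl)) hGint
  · intro k
    have := hX.measurable
    have := (G k).measurable
    fun_prop
  · exact fun k l hkl ω => iInf_mono fun N => hanti ω N hkl
  · exact ((lintegral_mono fun ω => infProd_le_one _).trans_lt (by simp)).ne

end

/-! ### Thinning -/

section

variable {Ω : Type*} [MeasurableSpace Ω] {μ : Measure Ω} [IsProbabilityMeasure μ]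

lemma lintegral_ite_bernoulli {act : Ω → Bool} (hact : Measurable act) {a : ℝ≥0∞} (ha : a ≤ 1) :
    ∫⁻ ω, (if act ω = true then a else 1) ∂μ = 1 - μ {ω | act ω = true} * (1 - a) := by
  have hs : MeasurableSet {ω | act ω = true} := hact (measurableSet_singleton true)
  have h : (fun ω => if act ω = true then a else 1)
      = fun ω => {ω | act ω = true}.indicator (fun _ => a) ω
        + {ω | act ω = true}ᶜ.indicator (fun _ => 1) ω := by
    ext ω
    by_cases h : act ω = true <;> simp [h]
  rw [h, lintegral_add_left (measurable_const.indicator hs), lintegral_indicator_const hs,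
    lintegral_indicator_const hs.compl, prob_compl_eq_one_sub hs, one_mul]
  set A := μ {ω | act ω = true}
  have hA : A ≤ 1 := prob_le_one
  refine ENNReal.eq_sub_of_add_eq ?_ ?_
  · exact ((mul_le_one' hA tsub_le_self).trans_lt ENNReal.one_lt_top).ne
  · rw [add_right_comm, mul_comm a, ← mul_add, add_tsub_cancel_of_le ha, mul_one,
      add_tsub_cancel_of_le hA]

/-- The joint generating functional of independent thinnings of independent Poisson processes. -/
theorem lintegral_prod_infProd_thinning {E ι : Type*} [MeasurableSpace E] [Fintype ι]
    {X : ι → ℕ → Ω → E} {Λ : ι → Measure E} [∀ j, SigmaFinite (Λ j)]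
    (hX : ∀ j, IsPoissonProcess (X j) (Λ j) μ) (hXi : iIndepFun (fun j ω n => X j n ω) μ)
    {act : ι → ℕ → Ω → Bool} (hact : ∀ j n, Measurable (act j n)) {A : ι → ℝ≥0∞}
    (hA : ∀ j n, μ {ω | act j n ω = true} = A j)
    (hacti : iIndepFun (fun p : ι × ℕ => act p.1 p.2) μ)
    (hind : IndepFun (fun ω j n => act j n ω) (fun ω j n => X j n ω) μ)
    {f : ι → E → ℝ≥0∞} (hf : ∀ j, Measurable (f j)) (hf1 : ∀ j x, f j x ≤ 1) :
    ∫⁻ ω, ∏ j, infProd (fun n => if act j n ω = true then f j (X j n ω) else 1) ∂μ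
      = ∏ j, expNeg (A j * ∫⁻ x, (1 - f j x) ∂Λ j) := by
  have hXm (j n) : Measurable (X j n) := (hX j).measurable n
  have h1 := hind.lintegral_comp_eq
    (F := fun a x => ∏ j, infProd (fun n => if a j n = true then f j (x j n) else 1))
    (by fun_prop) (by fun_prop) (by
      refine Finset.measurable_prod _ fun j _ => Measurable.infProd fun n => ?_
      refine Measurable.ite ?_ (by fun_prop) measurable_const
      have : Measurable fun p : (ι → ℕ → Bool) × (ι → ℕ → E) => p.1 j n := by fun_prop
      exact this (measurableSet_singleton true))
  rw [h1]
  have h2 (ω) : ∫⁻ ω', ∏ j, infProd (fun n => if act j n ω' = true then f j (X j n ω) else 1) ∂μ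
      = ∏ j, infProd fun n => 1 - A j * (1 - f j (X j n ω)) := by
    rw [lintegral_prod_infProd
      (Y := fun p ω' => if act p.1 p.2 ω' = true then f p.1 (X p.1 p.2 ω) else 1)]
    · simp_rw [lintegral_ite_bernoulli (hact _ _) (hf1 _ _), hA]
    · exact fun p => Measurable.ite (hact _ _ (measurableSet_singleton true)) measurable_const
        measurable_const
    · intro p ω'
      split_ifs <;> simp [hf1]
    · exact hacti.comp (fun p b => if b = true then f p.1 (X p.1 p.2 ω) else 1)
        fun p => Measurable.of_discrete
  simp_rw [h2]
  have hm (j) : Measurable fun x : E => A j * (1 - f j x) := by have := hf j; fun_prop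
  rw [lintegral_prod_eq_prod_lintegral_of_iIndepFun₀
    (Y := fun j ω => infProd fun n => 1 - A j * (1 - f j (X j n ω)))
    (hXi.comp (fun j x => infProd fun n => 1 - A j * (1 - f j (x n))) fun j => by fun_prop)
    (fun j => by fun_prop)]
  refine Finset.prod_congr rfl fun j _ => ?_
  have hA1 : A j ≤ 1 := hA j 0 ▸ prob_le_one
  rw [(hX j).lintegral_infProd_one_sub (hm j) fun x => mul_le_one' hA1 tsub_le_self,
    lintegral_const_mul _ (by have := hf j; fun_prop)]

end

/-! ### Radial integrals and Gamma integrals -/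

/-- Integration in polar coordinates of a function of the squared distance, in a space where
balls about `b` have the area of plane discs. -/
lemma lintegral_comp_dist_sq {E : Type*} [PseudoMetricSpace E] [MeasurableSpace E]
    [OpensMeasurableSpace E] {ν : Measure E} {b : E}
    (hν : ∀ r, 0 ≤ r → ν (Metric.ball b r) = ENNReal.ofReal (Real.pi * r ^ 2))
    {F : ℝ → ℝ≥0∞} (hF : Measurable F) :
    ∫⁻ x, F (dist x b ^ 2) ∂ν = ENNReal.ofReal Real.pi * ∫⁻ r in Ioi (0 : ℝ), F r := by
  have hm : Measurable fun x : E => dist x b ^ 2 := by fun_prop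
  have hmap (a c : ℝ) (hac : a < c) : ν.map (fun x => dist x b ^ 2) (Ico a c)
      = (ENNReal.ofReal Real.pi • volume.restrict (Ioi (0 : ℝ))) (Ico a c) := by
    have hpre : (fun x => dist x b ^ 2) ⁻¹' Ico a c
        = Metric.ball b (Real.sqrt c) \ Metric.ball b (Real.sqrt a) := by
      ext x
      simp [Real.lt_sqrt dist_nonneg, and_comm]
    rw [Measure.map_apply hm measurableSet_Ico, hpre, measure_sdiff
      (Metric.ball_subset_ball (Real.sqrt_le_sqrt hac.le))
      measurableSet_ball.nullMeasurableSet (by rw [hν _ (Real.sqrt_nonneg _)]; simp),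
      hν _ (Real.sqrt_nonneg _), hν _ (Real.sqrt_nonneg _), Real.sq_sqrt', Real.sq_sqrt',
      ← ENNReal.ofReal_sub _ (by positivity), Measure.smul_apply,
      Measure.restrict_congr_set Ioi_ae_eq_Ici, Measure.restrict_apply measurableSet_Ico,
      show Ico a c ∩ Ici 0 = Ico (max a 0) c by
        ext x; simp only [mem_inter_iff, mem_Ico, mem_Ici, max_le_iff]; tauto,
      Real.volume_Ico, smul_eq_mul, ← ENNReal.ofReal_mul Real.pi_pos.le, ← mul_sub]
    rcases le_total c 0 with hc | hc
    · rw [max_eq_right hc, max_eq_right (hac.le.trans hc), ENNReal.ofReal_of_nonpos (by simp),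
        ENNReal.ofReal_of_nonpos (mul_nonpos_of_nonneg_of_nonpos Real.pi_pos.le (by simpa))]
    · rw [max_eq_left hc]
  have hmap' : ν.map (fun x => dist x b ^ 2)
      = ENNReal.ofReal Real.pi • volume.restrict (Ioi (0 : ℝ)) := by
    refine Measure.ext_of_Ico' _ _ (fun a c hac => ?_) hmap
    rw [hmap a c hac, Measure.smul_apply, smul_eq_mul]
    exact ENNReal.mul_ne_top ENNReal.ofReal_ne_top
      ((Measure.restrict_apply_le _ _).trans_lt (by simp)).ne
  rw [← lintegral_map hF hm, hmap', lintegral_smul_measure, smul_eq_mul]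

lemma Plane.volume_ball (b : Plane) (r : ℝ) (hr : 0 ≤ r) :
    volume (Metric.ball b r) = ENNReal.ofReal (Real.pi * r ^ 2) := by
  rw [EuclideanSpace.volume_ball_fin_two, mul_comm, ← ENNReal.ofReal_pow hr,
    ← ENNReal.ofReal_mul Real.pi_pos.le]

lemma lintegral_rpow_mul_exp_neg_mul {s r : ℝ} (hs : 0 < s) (hr : 0 < r) :
    ∫⁻ t in Ioi (0 : ℝ), ENNReal.ofReal (t ^ (s - 1) * Real.exp (-(r * t)))
      = ENNReal.ofReal ((1 / r) ^ s * Real.Gamma s) := by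
  have h := Real.integral_rpow_mul_exp_neg_mul_Ioi hs hr
  have hpos : 0 < (1 / r) ^ s * Real.Gamma s := by
    have := Real.Gamma_pos_of_pos hs
    positivity
  have hint : IntegrableOn (fun t : ℝ => t ^ (s - 1) * Real.exp (-(r * t))) (Ioi 0) := by
    by_contra hn
    rw [integral_undef hn] at h
    exact hpos.ne h
  rw [← h, ofReal_integral_eq_lintegral_ofReal hint]
  filter_upwards [ae_restrict_mem measurableSet_Ioi] with t ht
  have : (0 : ℝ) < t := ht
  positivity

lemma lintegral_Ioi_exp_neg (s : ℝ) :
    ∫⁻ t in Ioi s, ENNReal.ofReal (Real.exp (-t)) = ENNReal.ofReal (Real.exp (-s)) := by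
  rw [← integral_exp_neg_Ioi, ofReal_integral_eq_lintegral_ofReal
    (integrableOn_exp_neg_Ioi s) (.of_forall fun t => (Real.exp_pos _).le)]

/-- The tail of the exponential distribution. -/
lemma lintegral_indicator_le_exp_neg (x : ℝ≥0∞) :
    ∫⁻ t in Ioi (0 : ℝ), {t | x ≤ ENNReal.ofReal t}.indicator
      (fun t => ENNReal.ofReal (Real.exp (-t))) t = expNeg x := by
  induction x using ENNReal.recTopCoe with
  | top => simp
  | coe x =>
    rw [← ENNReal.ofReal_coe_nnreal, expNeg_ofReal x.coe_nonneg, ← lintegral_Ioi_exp_neg,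
      ← lintegral_indicator measurableSet_Ioi, ← lintegral_indicator measurableSet_Ioi]
    refine lintegral_congr_ae ?_
    filter_upwards [Measure.ae_ne volume (x : ℝ)] with t ht
    by_cases hxt : (x : ℝ) < t
    · have h0 : 0 < t := x.coe_nonneg.trans_lt hxt
      rw [indicator_of_mem (mem_Ioi.2 h0), indicator_of_mem (mem_Ioi.2 hxt), indicator_of_mem]
      exact ENNReal.ofReal_le_ofReal hxt.le
    · have hxt' : ¬ (x : ℝ) ≤ t := fun h => hxt (lt_of_le_of_ne h ht.symm)
      by_cases h0 : 0 < t
      · simp [hxt, indicator, ENNReal.ofReal_le_ofReal_iff h0.le, hxt', h0,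
          -ENNReal.ofReal_coe_nnreal]
      · simp [hxt, indicator, h0]

lemma lintegral_indicator_lt_exp_neg (x : ℝ≥0∞) :
    ∫⁻ t in Ioi (0 : ℝ), {t | ENNReal.ofReal t < x}.indicator
      (fun t => ENNReal.ofReal (Real.exp (-t))) t = 1 - expNeg x := by
  have hs : MeasurableSet {t : ℝ | ENNReal.ofReal t < x} :=
    measurableSet_lt ENNReal.measurable_ofReal measurable_const
  refine ENNReal.eq_sub_of_add_eq (expNeg_ne_top x) ?_
  rw [← lintegral_indicator_le_exp_neg, show {t : ℝ | x ≤ ENNReal.ofReal t}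
    = {t : ℝ | ENNReal.ofReal t < x}ᶜ by ext; simp, lintegral_indicator hs,
    lintegral_indicator hs.compl, lintegral_add_compl _ hs, lintegral_Ioi_exp_neg]
  simp

/-- If `ν {h ≤ t} ≤ t` for all `t`, then `∫ e^{-h} dν ≤ 1 - e^{-ν(E)}`: among such measures the
integral is largest for Lebesgue measure on `[0, ν(E)]` and `h t = t`. -/
lemma expNeg_add_lintegral_expNeg_le_one {E : Type*} [MeasurableSpace E] (ν : Measure E)
    [SFinite ν] {h : E → ℝ≥0∞} (hh : Measurable h)
    (hν : ∀ t : ℝ, 0 < t → ν {x | h x ≤ ENNReal.ofReal t} ≤ ENNReal.ofReal t) :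
    expNeg (ν univ) + ∫⁻ x, expNeg (h x) ∂ν ≤ 1 := by
  set w : ℝ → ℝ≥0∞ := fun t => ENNReal.ofReal (Real.exp (-t))
  have hw : Measurable w := by fun_prop
  have key : ∫⁻ x, expNeg (h x) ∂ν
      ≤ ∫⁻ t in Ioi (0 : ℝ), min (ν univ) (ENNReal.ofReal t) * w t := by
    simp_rw [← lintegral_indicator_le_exp_neg]
    rw [lintegral_lintegral_swap]
    · refine setLIntegral_mono (by fun_prop) fun t ht => ?_
      have hs : MeasurableSet {x | h x ≤ ENNReal.ofReal t} :=
        measurableSet_le hh measurable_const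
      have : (fun x => {t | h x ≤ ENNReal.ofReal t}.indicator w t)
          = {x | h x ≤ ENNReal.ofReal t}.indicator fun _ => w t := by
        ext x; simp [indicator]
      rw [show (fun x => {t | h x ≤ ENNReal.ofReal t}.indicator
        (fun t => ENNReal.ofReal (Real.exp (-t))) t) = _ from this,
        lintegral_indicator_const hs, mul_comm]
      gcongr
      exact le_min (measure_mono (subset_univ _)) (hν t ht)
    · have hs : MeasurableSet {p : E × ℝ | h p.1 ≤ ENNReal.ofReal p.2} :=
        measurableSet_le (by fun_prop) (by fun_prop)
      exact ((hw.comp measurable_snd).indicator hs).aemeasurable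
  have hmin : ∫⁻ t in Ioi (0 : ℝ), min (ν univ) (ENNReal.ofReal t) * w t
      = 1 - expNeg (ν univ) := by
    have hvol (t : ℝ) (v : ℝ≥0∞) :
        volume ({s | ENNReal.ofReal s < v} ∩ Iio t ∩ Ioi 0) = min v (ENNReal.ofReal t) := by
      induction v using ENNReal.recTopCoe with
      | top =>
        rw [inter_assoc, inter_comm (Iio t), Ioi_inter_Iio]
        simp
      | coe v =>
        rw [show {s | ENNReal.ofReal s < v} ∩ Iio t ∩ Ioi 0 = Ioo 0 (min (v : ℝ) t) by
          ext s
          simp only [mem_inter_iff, mem_ofPred_eq, mem_Iio, mem_Ioi, mem_Ioo, lt_min_iff]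
          constructor
          · rintro ⟨⟨h1, h2⟩, h3⟩
            exact ⟨h3, (ENNReal.ofReal_lt_coe_iff h3.le).1 h1, h2⟩
          · rintro ⟨h3, h1, h2⟩
            exact ⟨⟨(ENNReal.ofReal_lt_coe_iff h3.le).2 h1, h2⟩, h3⟩, Real.volume_Ioo, sub_zero,
          ENNReal.ofReal_min, ENNReal.ofReal_coe_nnreal]
    rw [← lintegral_indicator_lt_exp_neg]
    have h1 (s : ℝ) : w s = ∫⁻ t, (Ioi s).indicator w t := by
      rw [lintegral_indicator measurableSet_Ioi, lintegral_Ioi_exp_neg]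
    have hs : MeasurableSet {s : ℝ | ENNReal.ofReal s < ν univ} :=
      measurableSet_lt ENNReal.measurable_ofReal measurable_const
    calc ∫⁻ t in Ioi (0 : ℝ), min (ν univ) (ENNReal.ofReal t) * w t
        = ∫⁻ t, ∫⁻ s in Ioi (0 : ℝ),
            ({s | ENNReal.ofReal s < ν univ} ∩ Iio t).indicator (fun _ => w t) s := by
          rw [← lintegral_indicator measurableSet_Ioi]
          refine lintegral_congr fun t => ?_
          rw [lintegral_indicator_const (hs.inter measurableSet_Iio),
            Measure.restrict_apply (hs.inter measurableSet_Iio), hvol, mul_comm]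
          by_cases ht : 0 < t
          · simp [ht]
          · simp [ht, ENNReal.ofReal_of_nonpos (not_lt.1 ht)]
      _ = ∫⁻ s in Ioi (0 : ℝ), ∫⁻ t,
            ({s | ENNReal.ofReal s < ν univ} ∩ Iio t).indicator (fun _ => w t) s := by
          refine lintegral_lintegral_swap ?_
          have hs1 : MeasurableSet {p : ℝ × ℝ | ENNReal.ofReal p.2 < ν univ} :=
            measurableSet_lt (by fun_prop) (by fun_prop)
          have hs2 : MeasurableSet {p : ℝ × ℝ | p.2 < p.1} :=
            measurableSet_lt (by fun_prop) (by fun_prop)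
          exact ((hw.comp measurable_fst).indicator (hs1.inter hs2)).aemeasurable
      _ = _ := by
          refine lintegral_congr fun s => ?_
          by_cases hsv : ENNReal.ofReal s < ν univ
          · refine Eq.trans (lintegral_congr fun t => ?_) ((h1 s).symm.trans ?_)
            · simp [indicator, hsv]
            · simp [indicator, hsv, w]
          · simp [indicator, hsv]
  calc _ ≤ expNeg (ν univ) + (1 - expNeg (ν univ)) := by rw [← hmin]; gcongr
    _ = 1 := add_tsub_cancel_of_le (expNeg_le_one _)

/-- `∫ (1 - e^{-c |y|^{-α}}) dy` over the plane. -/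
lemma lintegral_one_sub_expNeg_div_norm_rpow {α c : ℝ} (hα : 2 < α) (hc : 0 ≤ c) :
    ∫⁻ y : Plane, (1 - expNeg (ENNReal.ofReal (c / ‖y‖ ^ α)))
      = ENNReal.ofReal (Real.pi * (c ^ (2 / α) * Real.Gamma (1 - 2 / α))) := by
  have hα0 : 0 < α := by linarith
  have hδ1 : 2 / α < 1 := by rw [div_lt_one hα0]; exact hα
  rcases hc.eq_or_lt with rfl | hc
  · have : (0 : ℝ) ^ (2 / α) = 0 := Real.zero_rpow (by positivity)
    simp [this]
  simp_rw [← lintegral_indicator_lt_exp_neg]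
  rw [lintegral_lintegral_swap]
  · have hslice (t : ℝ) (ht : 0 < t) : ∫⁻ y : Plane,
        {t | ENNReal.ofReal t < ENNReal.ofReal (c / ‖y‖ ^ α)}.indicator
          (fun t => ENNReal.ofReal (Real.exp (-t))) t
        = ENNReal.ofReal (Real.pi * c ^ (2 / α)) *
          ENNReal.ofReal (t ^ ((1 - 2 / α) - 1) * Real.exp (-(1 * t))) := by
      have hae : (fun y : Plane => {t | ENNReal.ofReal t < ENNReal.ofReal (c / ‖y‖ ^ α)}.indicator
          (fun t => ENNReal.ofReal (Real.exp (-t))) t) =ᵐ[volume]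
          (Metric.ball (0 : Plane) ((c / t) ^ α⁻¹)).indicator
            fun _ => ENNReal.ofReal (Real.exp (-t)) := by
        filter_upwards [Measure.ae_ne volume (0 : Plane)] with y hy
        have hy' : 0 < ‖y‖ := norm_pos_iff.2 hy
        have hiff : ENNReal.ofReal t < ENNReal.ofReal (c / ‖y‖ ^ α)
            ↔ y ∈ Metric.ball (0 : Plane) ((c / t) ^ α⁻¹) := by
          rw [ENNReal.ofReal_lt_ofReal_iff (by positivity), mem_ball_zero_iff,
            Real.lt_rpow_inv_iff_of_pos hy'.le (by positivity) hα0,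
            lt_div_iff₀ (by positivity), lt_div_iff₀ ht, mul_comm]
        simp only [indicator, mem_ofPred_eq]
        split_ifs with h1 h2 h2
        exacts [rfl, absurd (hiff.1 h1) h2, absurd (hiff.2 h2) h1, rfl]
      rw [lintegral_congr_ae hae, lintegral_indicator_const measurableSet_ball,
        Plane.volume_ball _ _ (by positivity), ← ENNReal.ofReal_mul (by positivity),
        ← ENNReal.ofReal_mul (by positivity)]
      congr 1
      have h1 : ((c / t) ^ α⁻¹) ^ 2 = c ^ (2 / α) * t ^ (1 - 2 / α - 1) := by
        rw [← Real.rpow_natCast, ← Real.rpow_mul (by positivity), Real.div_rpow hc.le ht.le,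
          div_eq_mul_inv, ← Real.rpow_neg ht.le]
        congr 2 <;> push_cast <;> ring
      rw [h1, one_mul]; ring
    rw [setLIntegral_congr_fun measurableSet_Ioi fun t ht => hslice t ht,
      lintegral_const_mul _ (by fun_prop),
      lintegral_rpow_mul_exp_neg_mul (by linarith) one_pos, ← ENNReal.ofReal_mul (by positivity)]
    simp [mul_assoc]
  · have hs : MeasurableSet {p : Plane × ℝ |
        ENNReal.ofReal p.2 < ENNReal.ofReal (c / ‖p.1‖ ^ α)} :=
      measurableSet_lt (by fun_prop) (by fun_prop)
    exact ((show Measurable fun p : Plane × ℝ => ENNReal.ofReal (Real.exp (-p.2)) by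
      fun_prop).indicator hs).aemeasurable

/-- `∫ (1 - (1 + T |y|^{-α})^{-m}) dy` over the plane. The function `u ↦ (1 + u)^{-m}` is the
Laplace transform of the Gamma law of shape `m`. -/
theorem lintegral_one_sub_inv_one_add_div_norm_rpow {α T : ℝ} (hα : 2 < α) (hT : 0 ≤ T) {m : ℕ}
    (hm : 1 ≤ m) :
    ∫⁻ y : Plane, (1 - ENNReal.ofReal (((1 + T / ‖y‖ ^ α) ^ m)⁻¹))
      = ENNReal.ofReal (Real.pi * (T ^ (2 / α) *
          (Real.Gamma (m + 2 / α) * Real.Gamma (1 - 2 / α) / Real.Gamma m))) := by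
  have hα0 : 0 < α := by linarith
  have hm0 : (0 : ℝ) < m := by exact_mod_cast hm
  have hδ1 : 2 / α < 1 := by rw [div_lt_one hα0]; exact hα
  have hΓ := Real.Gamma_pos_of_pos hm0
  have hΓ1 : 0 < Real.Gamma (1 - 2 / α) := Real.Gamma_pos_of_pos (by linarith)
  set w : ℝ → ℝ≥0∞ := fun g => ENNReal.ofReal (g ^ ((m : ℝ) - 1) * Real.exp (-(1 * g))) with hw_def
  have hw : Measurable w := by fun_prop
  set G := ENNReal.ofReal (Real.Gamma m)
  have hG0 : G ≠ 0 := by simpa [G] using hΓ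
  have hGt : G ≠ ∞ := ENNReal.ofReal_ne_top
  have hw1 : ∫⁻ g in Ioi (0 : ℝ), w g = G := by
    rw [lintegral_rpow_mul_exp_neg_mul hm0 one_pos]; simp [G]
  have hlap (u : ℝ) (hu : 0 ≤ u) : G * (1 - ENNReal.ofReal (((1 + u) ^ m)⁻¹))
      = ∫⁻ g in Ioi (0 : ℝ), w g * (1 - expNeg (ENNReal.ofReal (u * g))) := by
    have h1 : ∫⁻ g in Ioi (0 : ℝ), w g * expNeg (ENNReal.ofReal (u * g))
        = G * ENNReal.ofReal (((1 + u) ^ m)⁻¹) := by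
      have := lintegral_rpow_mul_exp_neg_mul hm0 (show 0 < 1 + u by positivity)
      rw [← ENNReal.ofReal_mul hΓ.le, mul_comm (Real.Gamma m), ← inv_pow, ← one_div,
        ← Real.rpow_natCast, ← this]
      refine setLIntegral_congr_fun measurableSet_Ioi fun g (hg : 0 < g) => ?_
      simp only [hw_def]
      rw [expNeg_ofReal (by positivity), ← ENNReal.ofReal_mul (by positivity), mul_assoc,
        ← Real.exp_add]
      congr 4; ring
    simp_rw [ENNReal.mul_sub (fun _ _ => hGt), mul_one]
    rw [← h1, ← hw1, ← lintegral_sub (by fun_prop)]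
    · refine lintegral_congr fun g => ?_
      rw [ENNReal.mul_sub fun _ _ => by simp [hw_def], mul_one]
    · rw [h1]; exact ENNReal.mul_ne_top hGt (by simp)
    · exact .of_forall fun g => mul_le_of_le_one_right zero_le (expNeg_le_one _)
  have hmain : G * ∫⁻ y : Plane, (1 - ENNReal.ofReal (((1 + T / ‖y‖ ^ α) ^ m)⁻¹))
      = G * ENNReal.ofReal (Real.pi * (T ^ (2 / α) *
          (Real.Gamma (m + 2 / α) * Real.Gamma (1 - 2 / α) / Real.Gamma m))) := by
    rw [← lintegral_const_mul _ (by fun_prop)]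
    have hu (y : Plane) : 0 ≤ T / ‖y‖ ^ α := by positivity
    simp_rw [hlap _ (hu _)]
    rw [lintegral_lintegral_swap (by fun_prop)]
    have hslice (g : ℝ) (hg : 0 < g) : ∫⁻ y : Plane,
        w g * (1 - expNeg (ENNReal.ofReal (T / ‖y‖ ^ α * g)))
        = ENNReal.ofReal (Real.pi * T ^ (2 / α) * Real.Gamma (1 - 2 / α)) *
          ENNReal.ofReal (g ^ ((m + 2 / α) - 1) * Real.exp (-(1 * g))) := by
      simp_rw [div_mul_eq_mul_div]
      rw [lintegral_const_mul _ (by fun_prop),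
        lintegral_one_sub_expNeg_div_norm_rpow hα (by positivity)]
      simp only [hw_def]
      rw [← ENNReal.ofReal_mul (by positivity), ← ENNReal.ofReal_mul (by positivity),
        Real.mul_rpow hT hg.le, show (m + 2 / α) - 1 = ((m : ℝ) - 1) + 2 / α by ring,
        Real.rpow_add hg]
      congr 1; ring
    rw [setLIntegral_congr_fun measurableSet_Ioi fun g hg => hslice g hg,
      lintegral_const_mul _ (by fun_prop),
      lintegral_rpow_mul_exp_neg_mul (by positivity) one_pos,
      ← ENNReal.ofReal_mul (by positivity), ← ENNReal.ofReal_mul hΓ.le]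
    congr 1
    field_simp
    simp
  exact (ENNReal.mul_right_inj hG0 hGt).1 hmain

/-! ### Complex Gaussian vectors -/

lemma measurable_complex_mk : Measurable fun p : ℝ × ℝ => (⟨p.1, p.2⟩ : ℂ) :=
  Complex.measurableEquivRealProd.symm.measurable

instance : IsProbabilityMeasure cnLaw :=
  Measure.isProbabilityMeasure_map measurable_complex_mk.aemeasurable

instance (m : ℕ) : IsProbabilityMeasure (cnVecLaw m) := by unfold cnVecLaw; infer_instance

lemma charFun_cnLaw (t : ℂ) : charFun cnLaw t = Complex.exp (-(‖t‖ ^ 2 / 4 : ℝ)) := by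
  have h (p : ℝ × ℝ) : Complex.exp ((inner ℝ (⟨p.1, p.2⟩ : ℂ) t : ℝ) * Complex.I)
      = Complex.exp (t.re * p.1 * Complex.I) * Complex.exp (t.im * p.2 * Complex.I) := by
    rw [← Complex.exp_add, Complex.inner]
    congr 1
    simp
    ring
  rw [charFun_apply, cnLaw, integral_map measurable_complex_mk.aemeasurable (by fun_prop)]
  simp_rw [h]
  rw [integral_prod_mul (fun x : ℝ => Complex.exp (t.re * x * Complex.I))
    (fun x : ℝ => Complex.exp (t.im * x * Complex.I)), ← charFun_apply_real, ← charFun_apply_real,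
    charFun_gaussianReal, charFun_gaussianReal, ← Complex.exp_add, ← Complex.normSq_eq_norm_sq,
    Complex.normSq_apply]
  congr 1
  push_cast
  ring

lemma charFun_pi_cnLaw {κ : Type*} [Fintype κ] (t : PiLp 2 fun _ : κ => ℂ) :
    charFun ((Measure.pi fun _ : κ => cnLaw).map (WithLp.toLp 2)) t
      = Complex.exp (-((∑ i, ‖t i‖ ^ 2) / 4 : ℝ)) := by
  rw [charFun_pi]
  simp_rw [charFun_cnLaw, ← Complex.exp_sum]
  push_cast
  rw [Finset.sum_neg_distrib, Finset.sum_div]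

/-- A circularly symmetric Gaussian vector stays one under a matrix with orthonormal columns. -/
lemma map_vecMul_cnVecLaw {m : ℕ} {ι : Type*} [Fintype ι] [DecidableEq ι]
    {V : Matrix (Fin m) ι ℂ} (hV : Vᴴ * V = 1) :
    (cnVecLaw m).map (fun h => h ᵥ* V) = Measure.pi fun _ : ι => cnLaw := by
  have hm : Measurable fun h : Fin m → ℂ => h ᵥ* V := by
    refine measurable_pi_lambda _ fun l => ?_
    simp only [Matrix.vecMul, dotProduct]
    fun_prop
  have hLp : ((cnVecLaw m).map (fun h => h ᵥ* V)).map (WithLp.toLp 2)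
      = (Measure.pi fun _ : ι => cnLaw).map (WithLp.toLp 2) := by
    have := Measure.isProbabilityMeasure_map (μ := cnVecLaw m) hm.aemeasurable
    have h1 := Measure.isProbabilityMeasure_map (μ := (cnVecLaw m).map (fun h => h ᵥ* V))
      (WithLp.measurable_toLp 2 (ι → ℂ)).aemeasurable
    have h2 := Measure.isProbabilityMeasure_map (μ := Measure.pi fun _ : ι => cnLaw)
      (WithLp.measurable_toLp 2 (ι → ℂ)).aemeasurable
    refine Measure.ext_of_charFun (E := PiLp 2 fun _ : ι => ℂ) (funext fun t => ?_)
    set s : Fin m → ℂ := Vᴴᵀ *ᵥ t.ofLp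
    have hinner (h : Fin m → ℂ) : inner ℝ (WithLp.toLp 2 (h ᵥ* V) : PiLp 2 fun _ : ι => ℂ) t
        = inner ℝ (WithLp.toLp 2 h : PiLp 2 fun _ : Fin m => ℂ) (WithLp.toLp 2 s) := by
      have hd : star (h ᵥ* V) ⬝ᵥ t.ofLp = star h ⬝ᵥ s := by
        rw [Matrix.star_vecMul, Matrix.dotProduct_mulVec, Matrix.vecMul_transpose]
      have := congrArg Complex.re hd
      simpa [PiLp.inner_apply, Complex.inner, dotProduct, mul_comm] using this
    have hnorm : ∑ i, ‖s i‖ ^ 2 = ∑ l, ‖t l‖ ^ 2 := by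
      have hU : Vᴴᵀᴴ * Vᴴᵀ = 1 := by
        rw [show Vᴴᵀᴴ = Vᵀ by ext; simp, ← Matrix.transpose_mul, hV, Matrix.transpose_one]
      have hd : star s ⬝ᵥ s = star t.ofLp ⬝ᵥ t.ofLp := by
        rw [Matrix.star_mulVec, Matrix.dotProduct_mulVec, Matrix.vecMul_vecMul, hU,
          Matrix.vecMul_one]
      have hz (z : ℂ) : conj z * z = ((‖z‖ ^ 2 : ℝ) : ℂ) := by
        rw [← Complex.normSq_eq_conj_mul_self, Complex.normSq_eq_norm_sq]
      simp only [dotProduct, Pi.star_apply, RCLike.star_def, hz] at hd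
      exact_mod_cast hd
    rw [charFun_pi_cnLaw, ← hnorm, ← charFun_pi_cnLaw (WithLp.toLp 2 s), charFun_apply,
      charFun_apply, ← cnVecLaw,
      integral_map (by fun_prop) (by fun_prop), integral_map hm.aemeasurable (by fun_prop),
      integral_map (by fun_prop) (by fun_prop)]
    exact integral_congr_ae (.of_forall fun h => by simp only [hinner])
  have := congrArg (Measure.map WithLp.ofLp) hLp
  rw [Measure.map_map (by fun_prop) (by fun_prop), Measure.map_map (by fun_prop) (by fun_prop),
    Measure.map_map (by fun_prop) (by fun_prop)] at this
  simpa [Function.comp_def] using this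

/-- The signal and the artificial-noise components of the channel: independent Gaussians. -/
lemma map_dotProduct_vecMul_cnVecLaw {m n : ℕ} {w : Fin m → ℂ} {W : Matrix (Fin m) (Fin n) ℂ}
    (hw : star w ⬝ᵥ w = 1) (hW : Wᴴ * W = 1) (hwW : Wᴴ *ᵥ w = 0) :
    (cnVecLaw m).map (fun h => (h ⬝ᵥ w, h ᵥ* W)) = cnLaw.prod (cnVecLaw n) := by
  set V : Matrix (Fin m) (Fin (n + 1)) ℂ := Matrix.of fun i => Fin.cons (w i) (W i)
  have hV : Vᴴ * V = 1 := by
    ext i j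
    refine Fin.cases ?_ (fun i => ?_) i <;> refine Fin.cases ?_ (fun j => ?_) j
    · simpa [Matrix.mul_apply, V, dotProduct] using hw
    · have := congrArg star (congrFun hwW j)
      simpa [Matrix.mul_apply, V, Matrix.mulVec, dotProduct, Matrix.one_apply, mul_comm,
        (Fin.succ_ne_zero j).symm] using this
    · have := congrFun hwW i
      simpa [Matrix.mul_apply, V, Matrix.mulVec, dotProduct, Matrix.one_apply] using this
    · have := congrFun (congrFun hW i) j
      simpa [Matrix.mul_apply, V, Matrix.one_apply] using this
  have h1 := measurePreserving_piFinSuccAbove (fun _ : Fin (n + 1) => cnLaw) 0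
  have h2 := h1.map_eq
  have hm : Measurable fun h : Fin m → ℂ => h ᵥ* V := by
    refine measurable_pi_lambda _ fun l => ?_
    simp only [Matrix.vecMul, dotProduct]
    fun_prop
  rw [← map_vecMul_cnVecLaw hV, Measure.map_map h1.measurable hm] at h2
  exact h2

/-- The squared modulus of a `CN(0,1)` variable is exponentially distributed. -/
lemma lintegral_norm_sq_cnLaw {F : ℝ → ℝ≥0∞} (hF : Measurable F) :
    ∫⁻ z, F (‖z‖ ^ 2) ∂cnLaw = ∫⁻ r in Ioi (0 : ℝ), F r * ENNReal.ofReal (Real.exp (-r)) := by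
  have hpdf (p : ℝ × ℝ) : gaussianPDF 0 (1 / 2) p.1 * gaussianPDF 0 (1 / 2) p.2
      = ENNReal.ofReal (Real.pi⁻¹ * Real.exp (-(‖(⟨p.1, p.2⟩ : ℂ)‖ ^ 2))) := by
    rw [gaussianPDF, gaussianPDF, ← ENNReal.ofReal_mul (gaussianPDFReal_nonneg _ _ _),
      gaussianPDFReal, gaussianPDFReal, mul_mul_mul_comm, ← Real.exp_add,
      ← Complex.normSq_eq_norm_sq, Complex.normSq_apply, ← mul_inv,
      Real.mul_self_sqrt (by positivity)]
    congr 3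
    · push_cast; ring
    · push_cast; ring
  have hball (r : ℝ) (hr : 0 ≤ r) :
      volume (Metric.ball (0 : ℂ) r) = ENNReal.ofReal (Real.pi * r ^ 2) := by
    rw [Complex.volume_ball, ← ENNReal.ofReal_pow hr, mul_comm,
      ENNReal.ofReal_mul Real.pi_pos.le]
    congr 1
    exact (ENNReal.ofReal_coe_nnreal (p := NNReal.pi)).symm
  rw [cnLaw, lintegral_map (by fun_prop) measurable_complex_mk,
    gaussianReal_of_var_ne_zero _ (by norm_num), prod_withDensity (by fun_prop) (by fun_prop),
    lintegral_withDensity_eq_lintegral_mul _ (by fun_prop) (g := fun p : ℝ × ℝ =>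
      F (‖(⟨p.1, p.2⟩ : ℂ)‖ ^ 2))
      ((by fun_prop : Measurable fun z : ℂ => F (‖z‖ ^ 2)).comp measurable_complex_mk)]
  simp only [Pi.mul_apply, hpdf]
  rw [← Measure.volume_eq_prod]
  have h3 := Complex.volume_preserving_equiv_real_prod.symm.lintegral_comp
    (f := fun z : ℂ => ENNReal.ofReal (Real.pi⁻¹ * Real.exp (-(‖z‖ ^ 2))) * F (‖z‖ ^ 2))
    (by fun_prop)
  refine h3.trans ?_
  have h4 := lintegral_comp_dist_sq hball
    (F := fun r => ENNReal.ofReal (Real.pi⁻¹ * Real.exp (-r)) * F r) (by fun_prop)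
  simp only [dist_zero_right] at h4
  rw [h4, ← lintegral_const_mul _ (by fun_prop)]
  refine lintegral_congr fun r => ?_
  rw [← mul_assoc, ← ENNReal.ofReal_mul Real.pi_pos.le, mul_inv_cancel_left₀ Real.pi_ne_zero,
    mul_comm]

lemma cnLaw_setOf_le_mul_norm_sq {κ : ℝ} (hκ : 0 < κ) (x : ℝ≥0∞) :
    cnLaw {z | x ≤ ENNReal.ofReal (κ * ‖z‖ ^ 2)} = expNeg (x / ENNReal.ofReal κ) := by
  have hs : MeasurableSet {r : ℝ | x ≤ ENNReal.ofReal (κ * r)} :=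
    measurableSet_le (by fun_prop) (by fun_prop)
  have h := lintegral_norm_sq_cnLaw (F := {r : ℝ | x ≤ ENNReal.ofReal (κ * r)}.indicator 1)
    (measurable_one.indicator hs)
  have hs' : MeasurableSet {z : ℂ | x ≤ ENNReal.ofReal (κ * ‖z‖ ^ 2)} :=
    measurableSet_le (by fun_prop) (by fun_prop)
  rw [← lintegral_indicator_one hs', ← lintegral_indicator_le_exp_neg]
  refine Eq.trans (lintegral_congr fun z => ?_) (h.trans (lintegral_congr fun r => ?_))
  · simp [indicator]
  · have hiff : x / ENNReal.ofReal κ ≤ ENNReal.ofReal r ↔ x ≤ ENNReal.ofReal (κ * r) := by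
      rw [ENNReal.div_le_iff (by simpa using hκ) ENNReal.ofReal_ne_top, mul_comm,
        ENNReal.ofReal_mul hκ.le]
    simp only [indicator, mem_ofPred_eq, hiff, Pi.one_apply, ite_mul, one_mul, zero_mul]

lemma lintegral_expNeg_norm_sq_cnLaw {s : ℝ} (hs : 0 ≤ s) :
    ∫⁻ z, expNeg (ENNReal.ofReal (s * ‖z‖ ^ 2)) ∂cnLaw = ENNReal.ofReal (1 + s)⁻¹ := by
  rw [lintegral_norm_sq_cnLaw (F := fun r => expNeg (ENNReal.ofReal (s * r))) (by fun_prop)]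
  have h := lintegral_rpow_mul_exp_neg_mul one_pos (show 0 < 1 + s by positivity)
  simp only [sub_self, Real.rpow_zero, one_mul, Real.rpow_one, Real.Gamma_one, mul_one,
    one_div] at h
  rw [← h]
  refine setLIntegral_congr_fun measurableSet_Ioi fun r (hr : 0 < r) => ?_
  rw [expNeg_ofReal (by positivity), ← ENNReal.ofReal_mul (by positivity), ← Real.exp_add]
  congr 2; ring

lemma cnorm_sq {m : ℕ} (v : Fin m → ℂ) : cnorm v ^ 2 = ∑ i, ‖v i‖ ^ 2 :=
  Real.sq_sqrt (by positivity)

/-- The Laplace transform of the squared norm of a complex Gaussian vector. -/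
lemma lintegral_expNeg_cnorm_sq_cnVecLaw {s : ℝ} (hs : 0 ≤ s) (n : ℕ) :
    ∫⁻ v, expNeg (ENNReal.ofReal (s * cnorm v ^ 2)) ∂cnVecLaw n
      = ENNReal.ofReal ((1 + s) ^ n)⁻¹ := by
  have h (v : Fin n → ℂ) : expNeg (ENNReal.ofReal (s * cnorm v ^ 2))
      = ∏ i, expNeg (ENNReal.ofReal (s * ‖v i‖ ^ 2)) := by
    rw [cnorm_sq, Finset.mul_sum, ENNReal.ofReal_sum_of_nonneg fun i _ => by positivity,
      expNeg_sum]
  simp_rw [h]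
  rw [cnVecLaw, lintegral_prod_eq_prod_lintegral_of_iIndepFun₀
    (Y := fun i (v : Fin n → ℂ) => expNeg (ENNReal.ofReal (s * ‖v i‖ ^ 2)))
    (iIndepFun_pi (X := fun _ (z : ℂ) => expNeg (ENNReal.ofReal (s * ‖z‖ ^ 2)))
      fun i => by fun_prop) fun i => Measurable.aemeasurable (by fun_prop)]
  have h1 (i : Fin n) : ∫⁻ v : Fin n → ℂ, expNeg (ENNReal.ofReal (s * ‖v i‖ ^ 2))
      ∂(Measure.pi fun _ => cnLaw) = ENNReal.ofReal (1 + s)⁻¹ := by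
    rw [← lintegral_expNeg_norm_sq_cnLaw hs]
    exact (measurePreserving_eval (fun _ : Fin n => cnLaw) i).lintegral_comp
      (f := fun z => expNeg (ENNReal.ofReal (s * ‖z‖ ^ 2))) (by fun_prop)
  simp_rw [h1]
  rw [Finset.prod_const, Finset.card_univ, Fintype.card_fin, ← ENNReal.ofReal_pow (by positivity),
    inv_pow]

@[fun_prop]
lemma measurable_cnorm {m : ℕ} : Measurable (cnorm : (Fin m → ℂ) → ℝ) := by
  unfold cnorm; fun_prop

@[fun_prop]
lemma measurable_vecMul {m n : ℕ} (W : Matrix (Fin m) (Fin n) ℂ) :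
    Measurable fun h : Fin m → ℂ => h ᵥ* W := by
  refine measurable_pi_lambda _ fun l => ?_
  simp only [Matrix.vecMul, dotProduct]
  fun_prop

/-- The probability that the signal `κ |hᵀ w|²` reaches the level `c ‖hᵀ W‖² + J`, where `[w W]`
has orthonormal columns. -/
lemma cnVecLaw_setOf_le_signal {m n : ℕ} {w : Fin m → ℂ} {W : Matrix (Fin m) (Fin n) ℂ}
    (hw : star w ⬝ᵥ w = 1) (hW : Wᴴ * W = 1) (hwW : Wᴴ *ᵥ w = 0) {κ c : ℝ} (hκ : 0 < κ)
    (hc : 0 ≤ c) (J : ℝ≥0∞) :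
    cnVecLaw m {h | ENNReal.ofReal (c * cnorm (h ᵥ* W) ^ 2) + J
        ≤ ENNReal.ofReal (κ * ‖h ⬝ᵥ w‖ ^ 2)}
      = ENNReal.ofReal ((1 + c / κ) ^ n)⁻¹ * expNeg (J / ENNReal.ofReal κ) := by
  set s : Set (ℂ × (Fin n → ℂ)) :=
    {p | ENNReal.ofReal (c * cnorm p.2 ^ 2) + J ≤ ENNReal.ofReal (κ * ‖p.1‖ ^ 2)}
  have hs : MeasurableSet s := measurableSet_le (by fun_prop) (by fun_prop)
  have hm : Measurable fun h : Fin m → ℂ => (h ⬝ᵥ w, h ᵥ* W) := by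
    refine Measurable.prodMk ?_ (by fun_prop)
    simp only [dotProduct]
    fun_prop
  have h1 := Measure.map_apply (μ := cnVecLaw m) hm hs
  rw [map_dotProduct_vecMul_cnVecLaw hw hW hwW, Measure.prod_apply_symm hs] at h1
  refine h1.symm.trans ?_
  have h2 (v : Fin n → ℂ) : cnLaw ((fun z => (z, v)) ⁻¹' s)
      = expNeg (ENNReal.ofReal (c / κ * cnorm v ^ 2)) * expNeg (J / ENNReal.ofReal κ) := by
    rw [← expNeg_add, div_mul_eq_mul_div, ENNReal.ofReal_div_of_pos hκ, ← ENNReal.add_div]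
    rw [← cnLaw_setOf_le_mul_norm_sq hκ]
    rfl
  simp_rw [h2]
  rw [lintegral_mul_const _ (by fun_prop), lintegral_expNeg_cnorm_sq_cnVecLaw (by positivity)]

/-! ### The conditional law of the SINR of an Eve -/

section

variable {Ω : Type*} [MeasurableSpace Ω] {μ : Measure Ω}

/-- One variable of an independent family is independent of all the others together. -/
lemma ProbabilityTheory.iIndepFun.indepFun_pi_ne {ι : Type*} {γ : ι → Type*}
    [∀ i, MeasurableSpace (γ i)] {f : ∀ i, Ω → γ i} (hf : ∀ i, Measurable (f i))
    (h : iIndepFun f μ) (i : ι) :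
    IndepFun (f i) (fun ω (q : {q // q ≠ i}) => f q ω) μ := by
  have h1 : Indep (⨆ j ∈ ({i} : Set ι), MeasurableSpace.comap (f j) inferInstance)
      (⨆ j ∈ ({i}ᶜ : Set ι), MeasurableSpace.comap (f j) inferInstance) μ :=
    indep_iSup_of_disjoint (fun i => (hf i).comap_le) h.iIndep disjoint_compl_right
  rw [IndepFun_iff_Indep]
  refine indep_of_indep_of_le_left (indep_of_indep_of_le_right h1 ?_) ?_
  · rw [MeasurableSpace.pi, MeasurableSpace.comap_iSup]
    refine iSup_le fun q => ?_
    rw [MeasurableSpace.comap_comp]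
    have hq : q.1 ∈ ({i}ᶜ : Set ι) := q.2
    exact le_biSup (fun j => MeasurableSpace.comap (f j) inferInstance) hq
  · exact le_biSup (fun j => MeasurableSpace.comap (f j) inferInstance) (mem_singleton i)

end

lemma dotProduct_star_beam {m : ℕ} {h : Fin m → ℂ} (hh : h ≠ 0) : star (beam h) ⬝ᵥ beam h = 1 := by
  have h0 : 0 < ∑ i, ‖h i‖ ^ 2 := by
    obtain ⟨i, hi⟩ := Function.ne_iff.1 hh
    exact Finset.sum_pos' (fun _ _ => by positivity)
      ⟨i, Finset.mem_univ _, by have := norm_pos_iff.2 hi; positivity⟩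
  have hc : ((cnorm h : ℂ)) ^ 2 = ((∑ i, ‖h i‖ ^ 2 : ℝ) : ℂ) := by
    rw [← cnorm_sq]; push_cast; rfl
  have hz (z : ℂ) : z * conj z = ((‖z‖ ^ 2 : ℝ) : ℂ) := by
    rw [Complex.mul_conj, Complex.normSq_eq_norm_sq]
  have hne : ((∑ i, ‖h i‖ ^ 2 : ℝ) : ℂ) ≠ 0 := by exact_mod_cast h0.ne'
  simp only [dotProduct, Pi.star_apply, beam, RCLike.star_def, map_div₀, Complex.conj_conj,
    Complex.conj_ofReal, div_mul_div_comm, hz, ← pow_two ((cnorm h : ℂ)), hc]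
  rw [← Finset.sum_div, ← Complex.ofReal_sum, div_self hne]

lemma cnLaw_singleton_zero : cnLaw {0} = 0 := by
  have h := lintegral_norm_sq_cnLaw (F := ({0} : Set ℝ).indicator 1)
    (measurable_one.indicator (measurableSet_singleton 0))
  rw [← lintegral_indicator_one (measurableSet_singleton 0)]
  refine Eq.trans (lintegral_congr fun z => ?_) (h.trans ?_)
  · simp [indicator]
  · rw [setLIntegral_congr_fun (g := fun _ => 0) measurableSet_Ioi fun r (hr : 0 < r) => by
      simp [hr.ne']]
    simp

lemma ae_ne_zero_of_hasLaw {Ω : Type*} [MeasurableSpace Ω] {μ : Measure Ω} {m : ℕ}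
    {h : Ω → Fin m → ℂ} (hh : HasLaw h (cnVecLaw m) μ) (hm : 0 < m) : ∀ᵐ ω ∂μ, h ω ≠ 0 := by
  refine ae_of_ae_map hh.aemeasurable (p := fun v => v ≠ 0) ?_
  rw [hh.map_eq]
  have h1 := (measurePreserving_eval (fun _ : Fin m => cnLaw) ⟨0, hm⟩).quasiMeasurePreserving.ae
    (p := fun z => z ≠ 0) (by rw [ae_iff]; simpa using cnLaw_singleton_zero)
  filter_upwards [h1] with v hv h0
  exact hv (by rw [h0]; rfl)

namespace Network

variable {K : ℕ} (N : Network K)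

lemma M_sub_one_pos (j : Fin K) : (0 : ℝ) < (N.M j : ℝ) - 1 := by
  have : (2 : ℝ) ≤ N.M j := by exact_mod_cast N.two_le_M j
  linarith

lemma α_pos : 0 < N.α := by linarith [N.two_lt_α]

lemma ξ_nonneg (j : Fin K) : 0 ≤ N.ξ j :=
  div_nonneg (sub_nonneg.2 ((one_le_inv₀ (N.φ_pos j)).2 (N.φ_le_one j))) (N.M_sub_one_pos j).le

/-- The strength of the artificial noise of tier `j` relative to the signal of tier `k`, scaled by
the target SINR. -/
def noiseRatio (k : Fin K) (β : ℝ) (j : Fin K) : ℝ :=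
  β * (N.ξ j * (N.φ j / N.φ k) * (N.P j / N.P k))

lemma noiseRatio_nonneg (k : Fin K) {β : ℝ} (hβ : 0 < β) (j : Fin K) : 0 ≤ N.noiseRatio k β j := by
  have := N.ξ_nonneg j
  have := N.φ_pos j
  have := N.φ_pos k
  have := N.P_pos j
  have := N.P_pos k
  unfold noiseRatio
  positivity

/-- The factor by which an active BS of tier `j` at `y` lowers the probability that an Eve at `x`
intercepts the signal from `b`. -/
def bsFactor (k : Fin K) (b : Plane) (β : ℝ) (x : Plane) (j : Fin K) (y : Plane) : ℝ≥0∞ :=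
  ENNReal.ofReal ((1 + N.noiseRatio k β j * dist b x ^ N.α / dist y x ^ N.α) ^ (N.M j - 1))⁻¹

/-- The conditional probability that an Eve at `x` reaches the target SINR, given the locations `y`
and the activity `a` of the BSs. -/
def interceptProb (k : Fin K) (b : Plane) (β : ℝ) (x : Plane) (y : Fin K → ℕ → Plane)
    (a : Fin K → ℕ → Bool) : ℝ≥0∞ :=
  ENNReal.ofReal ((1 + N.ξ k * β) ^ (N.M k - 1))⁻¹ *
    (expNeg (ENNReal.ofReal (β * N.N0 / (N.φ k * N.P k) * dist b x ^ N.α)) *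
      ∏ j, infProd fun n => if a j n = true then N.bsFactor k b β x j (y j n) else 1)

lemma bsFactor_le_one (k : Fin K) (b : Plane) {β : ℝ} (hβ : 0 < β) (x : Plane) (j : Fin K)
    (y : Plane) : N.bsFactor k b β x j y ≤ 1 := by
  have := N.noiseRatio_nonneg k hβ j
  refine ENNReal.ofReal_le_one.2 (inv_le_one_of_one_le₀ (one_le_pow₀ ?_))
  rw [le_add_iff_nonneg_right]
  positivity

lemma interceptProb_le_one (k : Fin K) (b : Plane) {β : ℝ} (hβ : 0 < β) (x : Plane)
    (y : Fin K → ℕ → Plane) (a : Fin K → ℕ → Bool) : N.interceptProb k b β x y a ≤ 1 := by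
  have := N.ξ_nonneg k
  refine mul_le_one' (ENNReal.ofReal_le_one.2 (inv_le_one_of_one_le₀ (one_le_pow₀ ?_)))
    (mul_le_one' (expNeg_le_one _) (Finset.prod_le_one' fun j _ => infProd_le_one _))
  rw [le_add_iff_nonneg_right]
  positivity

lemma measurable_bsFactor {γ : Type*} [MeasurableSpace γ] (k : Fin K) (b : Plane) (β : ℝ)
    (j : Fin K) {f g : γ → Plane} (hf : Measurable f) (hg : Measurable g) :
    Measurable fun c => N.bsFactor k b β (f c) j (g c) := by
  unfold bsFactor; fun_prop

lemma measurable_interceptProb {γ : Type*} [MeasurableSpace γ] (k : Fin K) (b : Plane) (β : ℝ)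
    {x : γ → Plane} {y : γ → Fin K → ℕ → Plane} {a : γ → Fin K → ℕ → Bool} (hx : Measurable x)
    (hy : Measurable y) (ha : Measurable a) :
    Measurable fun c => N.interceptProb k b β (x c) (y c) (a c) := by
  have hy' (j n) : Measurable fun c => y c j n := by fun_prop
  have ha' (j n) : Measurable fun c => a c j n := by fun_prop
  unfold interceptProb
  refine Measurable.mul measurable_const (Measurable.mul (by fun_prop) ?_)
  refine Finset.measurable_prod _ fun j _ => Measurable.infProd fun n => ?_
  exact Measurable.ite (measurableSet_eq_fun (ha' j n) measurable_const)
    (N.measurable_bsFactor k b β j hx (hy' j n)) measurable_const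

/-- Everything but the channels to the Eves: the locations, the activity of the BSs, the channels
to the served UEs and the weight matrices of the artificial noise. -/
abbrev Env (k : Fin K) : Type :=
  ((Node K → ℕ → Plane) × (Fin K → ℕ → Bool)) ×
    (((z : Tx k) → Fin (N.M z.tier) → ℂ) ×
      ((z : Tx k) → Fin (N.M z.tier) → Fin (N.M z.tier - 1) → ℂ))

/-- The power of the artificial noise from a BS of tier `j` at distance `d`. -/
def noiseAt (j : Fin K) (d : ℝ) (h : Fin (N.M j) → ℂ)
    (W : Fin (N.M j) → Fin (N.M j - 1) → ℂ) : ℝ :=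
  (1 - N.φ j) * N.P j * cnorm (h ᵥ* Matrix.of W) ^ 2 / (((N.M j : ℝ) - 1) * d ^ N.α)

/-- The SINR of the `e`-th Eve as a function of its channels and of everything else. -/
def sinrAt (k : Fin K) (b : Plane) (e : ℕ) (h : (z : Tx k) → Fin (N.M z.tier) → ℂ)
    (y : N.Env k) : ℝ≥0∞ :=
  ENNReal.ofReal (N.φ k * N.P k * ‖h .serving ⬝ᵥ beam (y.2.1 .serving)‖ ^ 2 *
      dist b (y.1.1 .eve e) ^ (-N.α)) /
    (ENNReal.ofReal (N.noiseAt k (dist b (y.1.1 .eve e)) (h .serving) (y.2.2 .serving))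
      + ∑ j, ∑' n, (if y.1.2 j n = true then
          ENNReal.ofReal (N.noiseAt j (dist (y.1.1 (.bs j) n) (y.1.1 .eve e)) (h (.other j n))
            (y.2.2 (.other j n))) else 0)
      + ENNReal.ofReal N.N0)

end Network

namespace SecureTransmission

variable {K : ℕ} {N : Network K} {k : Fin K} {b : Plane} {Ω : Type*} [MeasurableSpace Ω]
  {μ : Measure Ω} (S : SecureTransmission N k b μ)

/-- Everything but the channels to the Eves. -/
def env (ω : Ω) : N.Env k :=
  ((fun s n => S.pt s n ω, fun j n => S.active j n ω),
    (fun z => S.hUser z ω, fun z i l => S.W z ω i l))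

lemma sinr_eq (e : ℕ) (ω : Ω) :
    S.sinr e ω = N.sinrAt k b e (fun z => S.hEve z e ω) (S.env ω) := rfl

end SecureTransmission

lemma ae_dotProduct_ne_zero {m n : ℕ} {w : Fin m → ℂ} {W : Matrix (Fin m) (Fin n) ℂ}
    (hw : star w ⬝ᵥ w = 1) (hW : Wᴴ * W = 1) (hwW : Wᴴ *ᵥ w = 0) :
    ∀ᵐ h ∂cnVecLaw m, h ⬝ᵥ w ≠ 0 := by
  have hm : Measurable fun h : Fin m → ℂ => (h ⬝ᵥ w, h ᵥ* W) := by
    refine Measurable.prodMk ?_ (by fun_prop)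
    simp only [dotProduct]
    fun_prop
  refine ae_of_ae_map hm.aemeasurable (p := fun q : ℂ × (Fin n → ℂ) => q.1 ≠ 0) ?_
  rw [map_dotProduct_vecMul_cnVecLaw hw hW hwW]
  exact Measure.quasiMeasurePreserving_fst.ae (p := fun z => z ≠ 0)
    (by rw [ae_iff]; simpa using cnLaw_singleton_zero)

namespace Network

variable {K : ℕ} (N : Network K)

lemma measurable_noiseAt {γ : Type*} [MeasurableSpace γ] (j : Fin K) {d : γ → ℝ}
    {h : γ → Fin (N.M j) → ℂ} {W : γ → Fin (N.M j) → Fin (N.M j - 1) → ℂ} (hd : Measurable d)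
    (hh : Measurable h) (hW : Measurable W) :
    Measurable fun c => N.noiseAt j (d c) (h c) (W c) := by
  have h1 : Measurable fun c => h c ᵥ* Matrix.of (W c) := by
    refine measurable_pi_lambda _ fun l => ?_
    simp only [Matrix.vecMul, dotProduct, Matrix.of_apply]
    fun_prop
  unfold noiseAt
  fun_prop

lemma measurable_sinrAt {γ : Type*} [MeasurableSpace γ] (k : Fin K) (b : Plane) (e : ℕ)
    {h : γ → (z : Tx k) → Fin (N.M z.tier) → ℂ} {y : γ → N.Env k} (hh' : Measurable h)
    (hy : Measurable y) : Measurable fun c => N.sinrAt k b e (h c) (y c) := by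
  have hpt (s n) : Measurable fun c => (y c).1.1 s n := by fun_prop
  have hact (j n) : Measurable fun c => (y c).1.2 j n := by fun_prop
  have hh (z) : Measurable fun c => h c z := by fun_prop
  have hu (z) : Measurable fun c => (y c).2.1 z := by fun_prop
  have hW (z) : Measurable fun c => (y c).2.2 z := by fun_prop
  have hbeam : Measurable fun c =>
      h c .serving ⬝ᵥ beam ((y c).2.1 .serving) := by
    have h1 := hh .serving
    have h2 := hu .serving
    have h3 := measurable_cnorm.comp h2
    simp only [dotProduct, beam]
    refine Finset.measurable_sum _ fun i _ => Measurable.mul (by fun_prop) (Measurable.div ?_ ?_)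
    · exact Complex.continuous_conj.measurable.comp ((measurable_pi_apply i).comp h2)
    · exact Complex.measurable_ofReal.comp h3
  have hown : Measurable fun c =>
      ENNReal.ofReal (N.noiseAt k (dist b ((y c).1.1 .eve e)) (h c .serving)
        ((y c).2.2 .serving)) :=
    (N.measurable_noiseAt k (measurable_const.dist (hpt .eve e)) (hh .serving)
      (hW .serving)).ennreal_ofReal
  have hothers (j n) : Measurable fun c =>
      if (y c).1.2 j n = true then ENNReal.ofReal (N.noiseAt j
        (dist ((y c).1.1 (.bs j) n) ((y c).1.1 .eve e)) (h c (.other j n)) ((y c).2.2 (.other j n)))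
      else 0 :=
    Measurable.ite (measurableSet_eq_fun (hact j n) measurable_const)
      (N.measurable_noiseAt j ((hpt (.bs j) n).dist (hpt .eve e)) (hh (.other j n))
        (hW (.other j n))).ennreal_ofReal measurable_const
  have hsum := Finset.measurable_sum Finset.univ fun j _ =>
    Measurable.tsum (L := SummationFilter.unconditional ℕ) (hothers j)
  unfold sinrAt
  exact Measurable.div (by fun_prop) ((hown.add hsum).add measurable_const)

/-- The average over the channel of the factor that an active BS contributes. -/
lemma lintegral_expNeg_noiseAt (k : Fin K) (b x y : Plane) (hx : x ≠ b) {β : ℝ} (hβ : 0 < β)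
    (j : Fin K) (W : Fin (N.M j) → Fin (N.M j - 1) → ℂ)
    (hW : (Matrix.of W)ᴴ * Matrix.of W = 1) :
    ∫⁻ h, expNeg (ENNReal.ofReal β * ENNReal.ofReal (N.noiseAt j (dist y x) h W) /
      ENNReal.ofReal (N.φ k * N.P k * dist b x ^ (-N.α))) ∂cnVecLaw (N.M j)
      = N.bsFactor k b β x j y := by
  have hr : 0 < dist b x := dist_pos.2 hx.symm
  have hφk := N.φ_pos k
  have hPk := N.P_pos k
  have hφj := N.φ_pos j
  have hM := N.M_sub_one_pos j
  have hκ : 0 < N.φ k * N.P k * dist b x ^ (-N.α) := by positivity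
  set s := N.noiseRatio k β j * dist b x ^ N.α / dist y x ^ N.α with hs_def
  have hs : 0 ≤ s := by
    have := N.noiseRatio_nonneg k hβ j
    positivity
  have h1 (h : Fin (N.M j) → ℂ) : ENNReal.ofReal β *
      ENNReal.ofReal (N.noiseAt j (dist y x) h W) /
        ENNReal.ofReal (N.φ k * N.P k * dist b x ^ (-N.α))
      = ENNReal.ofReal (s * cnorm (h ᵥ* Matrix.of W) ^ 2) := by
    rw [← ENNReal.ofReal_mul hβ.le, ← ENNReal.ofReal_div_of_pos hκ]
    congr 1
    have hAN : N.noiseAt j (dist y x) h W = (1 - N.φ j) * N.P j *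
        cnorm (h ᵥ* Matrix.of W) ^ 2 / ((N.M j : ℝ) - 1) * (dist y x ^ N.α)⁻¹ := by
      rw [noiseAt, ← div_div, div_eq_mul_inv]
    rw [hAN, hs_def, noiseRatio, ξ, Real.rpow_neg hr.le, div_eq_mul_inv _ (dist y x ^ N.α)]
    generalize (dist y x ^ N.α)⁻¹ = D
    have : 0 < dist b x ^ N.α := by positivity
    field_simp
  simp_rw [h1]
  have hm := measurable_vecMul (Matrix.of W)
  rw [← lintegral_map (f := fun v => expNeg (ENNReal.ofReal (s * cnorm v ^ 2))) (by fun_prop) hm,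
    map_vecMul_cnVecLaw hW, ← cnVecLaw, lintegral_expNeg_cnorm_sq_cnVecLaw hs, bsFactor]

/-- The probability, over independent channels `Hs` from the serving BS and `H j n` from the other
BSs to an Eve at `x`, that the Eve reaches the target SINR. -/
theorem measure_le_sinr_of_indep {k : Fin K} {Ω : Type*} [MeasurableSpace Ω] {μ : Measure Ω}
    [IsProbabilityMeasure μ] {Hs : Ω → Fin (N.M k) → ℂ} {H : (j : Fin K) → ℕ → Ω → Fin (N.M j) → ℂ}
    (hHsm : Measurable Hs) (hHm : ∀ j n, Measurable (H j n)) (hHs : HasLaw Hs (cnVecLaw (N.M k)) μ)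
    (hH : ∀ j n, HasLaw (H j n) (cnVecLaw (N.M j)) μ)
    (hsH : IndepFun Hs (fun ω j n => H j n ω) μ)
    (hHi : iIndepFun (fun p : Fin K × ℕ => H p.1 p.2) μ) (b : Plane) {β : ℝ} (hβ : 0 < β)
    {x : Plane} (hx : x ≠ b) (y : Fin K → ℕ → Plane) (a : Fin K → ℕ → Bool)
    {w : Fin (N.M k) → ℂ} {Ws : Fin (N.M k) → Fin (N.M k - 1) → ℂ}
    {W : (j : Fin K) → ℕ → Fin (N.M j) → Fin (N.M j - 1) → ℂ} (hw : star w ⬝ᵥ w = 1)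
    (hWs : (Matrix.of Ws)ᴴ * Matrix.of Ws = 1) (hwW : (Matrix.of Ws)ᴴ *ᵥ w = 0)
    (hW : ∀ j n, (Matrix.of (W j n))ᴴ * Matrix.of (W j n) = 1) :
    μ {ω | ENNReal.ofReal β ≤ ENNReal.ofReal (N.φ k * N.P k * ‖Hs ω ⬝ᵥ w‖ ^ 2 *
        dist b x ^ (-N.α)) / (ENNReal.ofReal (N.noiseAt k (dist b x) (Hs ω) Ws)
        + ∑ j, ∑' n, (if a j n = true then
            ENNReal.ofReal (N.noiseAt j (dist (y j n) x) (H j n ω) (W j n)) else 0)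
        + ENNReal.ofReal N.N0)}
      = N.interceptProb k b β x y a := by
  have hr : 0 < dist b x := dist_pos.2 hx.symm
  have hφk := N.φ_pos k
  have hPk := N.P_pos k
  have hMk := N.M_sub_one_pos k
  set κ := N.φ k * N.P k * dist b x ^ (-N.α) with hκ_def
  have hκ : 0 < κ := by positivity
  set c := β * ((1 - N.φ k) * N.P k / ((N.M k - 1) * dist b x ^ N.α)) with hc_def
  have hc : 0 ≤ c := by
    have : 0 ≤ 1 - N.φ k := sub_nonneg.2 (N.φ_le_one k)
    positivity
  have hcκ : c / κ = N.ξ k * β := by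
    rw [hc_def, hκ_def, ξ, Real.rpow_neg hr.le]
    have : 0 < dist b x ^ N.α := by positivity
    field_simp
  -- the interference and noise from all but the serving BS, as a function of the channels
  set u : (j : Fin K) → ℕ → (Fin (N.M j) → ℂ) → ℝ≥0∞ := fun j n h =>
    if a j n = true then ENNReal.ofReal (N.noiseAt j (dist (y j n) x) h
      (W j n)) else 0 with hu_def
  have hum (j n) : Measurable (u j n) := by
    simp only [hu_def]
    split_ifs
    · exact (N.measurable_noiseAt j measurable_const measurable_id
        measurable_const).ennreal_ofReal
    · exact measurable_const
  set J : Ω → ℝ≥0∞ := fun ω => ENNReal.ofReal β *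
    (∑ j, ∑' n, u j n (H j n ω) + ENNReal.ofReal N.N0)
  have hJm : Measurable J := by
    have h (j n) : Measurable fun ω => u j n (H j n ω) :=
      (hum j n).comp (hHm j n)
    exact ((Finset.measurable_sum _ fun j _ => Measurable.tsum (h j)).add_const _).const_mul
      _
  have hind : IndepFun Hs J μ := by
    have h' (j n) : Measurable fun v : (j : Fin K) → ℕ → Fin (N.M j) → ℂ => u j n (v j n) :=
      (hum j n).comp (by fun_prop)
    exact hsH.comp measurable_id
      (((Finset.measurable_sum _ fun j _ => Measurable.tsum (h' j)).add_const _).const_mul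
        (ENNReal.ofReal β))
  -- the two events differ only where signal and denominator vanish, since `0 / 0 = 0 < β`; the
  -- signal vanishes on a null event only
  have hevent : {ω | ENNReal.ofReal β ≤ ENNReal.ofReal (N.φ k * N.P k * ‖Hs ω ⬝ᵥ w‖ ^ 2 *
      dist b x ^ (-N.α)) / (ENNReal.ofReal (N.noiseAt k (dist b x) (Hs ω) Ws)
        + ∑ j, ∑' n, u j n (H j n ω) + ENNReal.ofReal N.N0)} =ᵐ[μ]
      {ω | ENNReal.ofReal (c * cnorm (Hs ω ᵥ* Matrix.of Ws) ^ 2) + J ω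
        ≤ ENNReal.ofReal (κ * ‖Hs ω ⬝ᵥ w‖ ^ 2)} := by
    have hne : ∀ᵐ ω ∂μ, Hs ω ⬝ᵥ w ≠ 0 :=
      ae_of_ae_map hHs.aemeasurable (p := fun h => h ⬝ᵥ w ≠ 0)
        (hHs.map_eq ▸ ae_dotProduct_ne_zero hw hWs hwW)
    refine eventuallyEq_set.2 ?_
    filter_upwards [hne] with ω hω
    have hsig : N.φ k * N.P k * ‖Hs ω ⬝ᵥ w‖ ^ 2 * dist b x ^ (-N.α) = κ * ‖Hs ω ⬝ᵥ w‖ ^ 2 := by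
      rw [hκ_def]; ring
    have hpos : 0 < κ * ‖Hs ω ⬝ᵥ w‖ ^ 2 := by
      have := norm_pos_iff.2 hω
      positivity
    have hAN : ENNReal.ofReal β * ENNReal.ofReal (N.noiseAt k (dist b x) (Hs ω)
        Ws) = ENNReal.ofReal (c * cnorm (Hs ω ᵥ* Matrix.of Ws) ^ 2) := by
      rw [← ENNReal.ofReal_mul hβ.le, hc_def, noiseAt]
      congr 1; ring
    change ENNReal.ofReal β ≤ _ / _ ↔
      ENNReal.ofReal (c * cnorm (Hs ω ᵥ* Matrix.of Ws) ^ 2) + J ω ≤ _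
    rw [hsig, ENNReal.le_div_iff_mul_le (Or.inr (by simpa using hpos))
      (Or.inr ENNReal.ofReal_ne_top), add_assoc, mul_add, hAN]
  have hset : MeasurableSet {p : (Fin (N.M k) → ℂ) × ℝ≥0∞ |
      ENNReal.ofReal (c * cnorm (p.1 ᵥ* Matrix.of Ws) ^ 2) + p.2
        ≤ ENNReal.ofReal (κ * ‖p.1 ⬝ᵥ w‖ ^ 2)} := by
    have h1 : Measurable fun p : (Fin (N.M k) → ℂ) × ℝ≥0∞ => p.1 ᵥ* Matrix.of Ws :=
      (measurable_vecMul (Matrix.of Ws)).comp measurable_fst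
    have h2 : Measurable fun p : (Fin (N.M k) → ℂ) × ℝ≥0∞ => p.1 ⬝ᵥ w := by
      simp only [dotProduct]; fun_prop
    exact measurableSet_le (by fun_prop) (by fun_prop)
  have hprob : μ {ω | ENNReal.ofReal (c * cnorm (Hs ω ᵥ* Matrix.of Ws) ^ 2) + J ω
      ≤ ENNReal.ofReal (κ * ‖Hs ω ⬝ᵥ w‖ ^ 2)}
      = ENNReal.ofReal ((1 + N.ξ k * β) ^ (N.M k - 1))⁻¹ *
        ∫⁻ ω, expNeg (J ω / ENNReal.ofReal κ) ∂μ := by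
    have h1 := hind.lintegral_comp_eq hHsm hJm
      (F := fun h v => {p : (Fin (N.M k) → ℂ) × ℝ≥0∞ |
        ENNReal.ofReal (c * cnorm (p.1 ᵥ* Matrix.of Ws) ^ 2) + p.2
          ≤ ENNReal.ofReal (κ * ‖p.1 ⬝ᵥ w‖ ^ 2)}.indicator 1 (h, v))
      (measurable_one.indicator hset)
    have h2 (v : ℝ≥0∞) : ∫⁻ ω, {p : (Fin (N.M k) → ℂ) × ℝ≥0∞ |
        ENNReal.ofReal (c * cnorm (p.1 ᵥ* Matrix.of Ws) ^ 2) + p.2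
          ≤ ENNReal.ofReal (κ * ‖p.1 ⬝ᵥ w‖ ^ 2)}.indicator 1 (Hs ω, v) ∂μ
        = ENNReal.ofReal ((1 + N.ξ k * β) ^ (N.M k - 1))⁻¹ * expNeg (v / ENNReal.ofReal κ) := by
      have hpre := hset.preimage (measurable_prodMk_right (y := v))
      rw [← hcκ, ← cnVecLaw_setOf_le_signal hw hWs hwW hκ hc v, ← hHs.map_eq]
      exact (lintegral_indicator_one (hHsm hpre)).trans (Measure.map_apply hHsm hpre).symm
    simp_rw [h2] at h1
    rw [lintegral_const_mul _ (by fun_prop)] at h1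
    rw [← h1]
    exact (lintegral_indicator_one (hset.preimage (hHsm.prodMk hJm))).symm
  rw [measure_congr hevent, hprob, interceptProb]
  congr 1
  -- the Laplace transform of the interference
  have hdiv (ω) : expNeg (J ω / ENNReal.ofReal κ)
      = expNeg (ENNReal.ofReal (β * N.N0 / (N.φ k * N.P k) * dist b x ^ N.α)) *
        ∏ j, infProd fun n =>
          expNeg (ENNReal.ofReal β * u j n (H j n ω) / ENNReal.ofReal κ) := by
    have hN : ENNReal.ofReal β * ENNReal.ofReal N.N0 / ENNReal.ofReal κ
        = ENNReal.ofReal (β * N.N0 / (N.φ k * N.P k) * dist b x ^ N.α) := by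
      rw [← ENNReal.ofReal_mul hβ.le, ← ENNReal.ofReal_div_of_pos hκ, hκ_def,
        Real.rpow_neg hr.le]
      congr 1
      have : 0 < dist b x ^ N.α := by positivity
      field_simp
    have hprod : ∏ j, infProd (fun n =>
        expNeg (ENNReal.ofReal β * u j n (H j n ω) / ENNReal.ofReal κ))
        = expNeg (∑ j, ∑' n, ENNReal.ofReal β * u j n (H j n ω) / ENNReal.ofReal κ) := by
      rw [expNeg_sum]
      exact Finset.prod_congr rfl fun j _ => infProd_expNeg _
    rw [hprod, ← expNeg_add, ← hN]
    simp_rw [div_eq_mul_inv, ENNReal.tsum_mul_right, ENNReal.tsum_mul_left, ← Finset.sum_mul,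
      ← Finset.mul_sum]
    rw [← add_mul, ← mul_add, add_comm]
  simp_rw [hdiv]
  have hYm (p : Fin K × ℕ) : Measurable fun ω => expNeg (ENNReal.ofReal β *
      u p.1 p.2 (H p.1 p.2 ω) / ENNReal.ofReal κ) := by
    have : Measurable fun ω => u p.1 p.2 (H p.1 p.2 ω) :=
      (hum p.1 p.2).comp (hHm p.1 p.2)
    fun_prop
  rw [lintegral_const_mul _ (Finset.measurable_prod _ fun j _ =>
    Measurable.infProd fun n => hYm (j, n))]
  congr 1
  rw [lintegral_prod_infProd hYm (fun _ _ => expNeg_le_one _)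
    (hHi.comp (fun p h => expNeg (ENNReal.ofReal β * u p.1 p.2 h / ENNReal.ofReal κ)) fun p => by
      have := hum p.1 p.2
      fun_prop)]
  refine Finset.prod_congr rfl fun j _ => congrArg infProd (funext fun n => ?_)
  by_cases ha : a j n = true
  · simp only [hu_def, ha, if_true]
    rw [← N.lintegral_expNeg_noiseAt k b x (y j n) hx hβ j (W j n)
      (hW j n), ← (hH j n).map_eq]
    refine (lintegral_map (f := fun h => expNeg (ENNReal.ofReal β * ENNReal.ofReal
      (N.noiseAt j (dist (y j n) x) h (W j n)) / ENNReal.ofReal κ)) ?_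
      (hHm j n)).symm
    have := N.measurable_noiseAt (W := fun _ => W j n) j
      (measurable_const (a := dist (y j n) x)) measurable_id measurable_const
    simp only [id] at this
    exact measurable_expNeg.comp ((this.ennreal_ofReal.const_mul _).div_const _)
  · simp [hu_def, ha]

end Network

namespace SecureTransmission

variable {K : ℕ} {N : Network K} {k : Fin K} {b : Plane} {Ω : Type*} [MeasurableSpace Ω]
  {μ : Measure Ω} (S : SecureTransmission N k b μ)

lemma indepFun_hEve_serving (e : ℕ) :
    IndepFun (S.hEve .serving e)
      (fun ω j n => S.hEve (.other j n) e ω : Ω → (j : Fin K) → ℕ → Fin (N.M j) → ℂ) μ := by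
  have h : IndepFun (S.hEve .serving e)
      (fun ω (q : {q : Tx k × ℕ // q ≠ (.serving, e)}) => S.hEve q.1.1 q.1.2 ω) μ :=
    S.hEve_iIndep.indepFun_pi_ne (fun p => S.hEve_measurable p.1 p.2) (.serving, e)
  have hne (j n) : ((.other j n : Tx k), e) ≠ (.serving, e) := by simp
  have hψ : Measurable fun (v : (q : {q : Tx k × ℕ // q ≠ (.serving, e)}) →
      Fin (N.M q.1.1.tier) → ℂ) (j : Fin K) (n : ℕ) =>
        (v ⟨(.other j n, e), hne j n⟩ : Fin (N.M j) → ℂ) :=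
    measurable_pi_lambda _ fun j => measurable_pi_lambda _ fun n => measurable_pi_apply _
  exact h.comp measurable_id hψ

/-- The probability, over the channels to an Eve, that the Eve reaches the target SINR, everything
else being fixed. -/
theorem measure_le_sinrAt [IsProbabilityMeasure μ] {β : ℝ} (hβ : 0 < β) (e : ℕ) (y : N.Env k)
    (hy : y.1.1 .eve e ≠ b)
    (hw : star (beam (y.2.1 .serving)) ⬝ᵥ beam (y.2.1 .serving) = 1)
    (hW : ∀ z, (Matrix.of (y.2.2 z))ᴴ * Matrix.of (y.2.2 z) = 1)
    (hwW : (Matrix.of (y.2.2 .serving))ᴴ *ᵥ beam (y.2.1 .serving) = 0) :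
    μ {ω | ENNReal.ofReal β ≤ N.sinrAt k b e (fun z => S.hEve z e ω) y}
      = N.interceptProb k b β (y.1.1 .eve e) (fun j n => y.1.1 (.bs j) n) y.1.2 := by
  have hinj : Function.Injective fun p : Fin K × ℕ => ((.other p.1 p.2 : Tx k), e) := by
    rintro ⟨j, n⟩ ⟨j', n'⟩ h
    simpa using h
  exact N.measure_le_sinr_of_indep (S.hEve_measurable .serving e)
    (fun j n => S.hEve_measurable (.other j n) e) (S.hEve_law .serving e)
    (fun j n => S.hEve_law (.other j n) e) (S.indepFun_hEve_serving e)
    (S.hEve_iIndep.precomp hinj) b hβ hy _ _ hw (hW .serving) hwW fun j n => hW (.other j n)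

end SecureTransmission

instance {K : ℕ} (k : Fin K) : Countable (Tx k) := by
  refine Function.Injective.countable (β := Option (Fin K × ℕ))
    (f := fun z => match z with
      | .serving => none
      | .other j n => some (j, n)) ?_
  rintro (_ | ⟨j, n⟩) (_ | ⟨j', n'⟩) h <;> simp_all

lemma homogeneous_eq_zero {ℓ : ℝ} {B : Set Plane} (hB : volume B = 0) : homogeneous ℓ B = 0 := by
  simp [homogeneous, hB]

lemma lintegral_homogeneous (ℓ : ℝ) (f : Plane → ℝ≥0∞) :
    ∫⁻ x, f x ∂homogeneous ℓ = ENNReal.ofReal ℓ * ∫⁻ x, f x := by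
  rw [homogeneous, lintegral_smul_measure, smul_eq_mul]

instance (ℓ : ℝ) : SigmaFinite (homogeneous ℓ) := by
  change SigmaFinite ((ℓ.toNNReal : ℝ≥0) • (volume : Measure Plane))
  infer_instance

section

variable {Ω : Type*} [MeasurableSpace Ω] {μ : Measure Ω}

lemma ProbabilityTheory.IndepFun.prodMk_right_of_indepFun_prodMk {α β γ : Type*}
    [MeasurableSpace α] [MeasurableSpace β] [MeasurableSpace γ] [IsProbabilityMeasure μ]
    {X : Ω → α} {Y : Ω → β} {Z : Ω → γ} (hX : Measurable X) (hY : Measurable Y) (hZ : Measurable Z)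
    (hXY : IndepFun X Y μ) (h : IndepFun Z (fun ω => (X ω, Y ω)) μ) :
    IndepFun X (fun ω => (Y ω, Z ω)) μ := by
  have := Measure.isProbabilityMeasure_map (μ := μ) hX.aemeasurable
  have := Measure.isProbabilityMeasure_map (μ := μ) hY.aemeasurable
  have := Measure.isProbabilityMeasure_map (μ := μ) hZ.aemeasurable
  have hYZ : IndepFun Y Z μ := (h.comp measurable_id measurable_snd).symm
  rw [indepFun_iff_map_prod_eq_prod_map_map hX.aemeasurable (by fun_prop),
    (indepFun_iff_map_prod_eq_prod_map_map hY.aemeasurable hZ.aemeasurable).1 hYZ]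
  have h1 := (indepFun_iff_map_prod_eq_prod_map_map (by fun_prop) hZ.aemeasurable).1 h.symm
  rw [(indepFun_iff_map_prod_eq_prod_map_map hX.aemeasurable hY.aemeasurable).1 hXY] at h1
  rw [← Measure.prodAssoc_prod, ← h1, Measure.map_map MeasurableEquiv.prodAssoc.measurable
    (by fun_prop)]
  rfl

end

namespace SecureTransmission

variable {K : ℕ} {N : Network K} {k : Fin K} {b : Plane} {Ω : Type*} [MeasurableSpace Ω]
  {μ : Measure Ω} (S : SecureTransmission N k b μ)

lemma measurable_pt (s : Node K) (n : ℕ) : Measurable (S.pt s n) := (S.poisson s).measurable n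

lemma measurable_env : Measurable S.env := by
  have h1 := S.measurable_pt
  have h2 := S.active_measurable
  have h3 := S.hUser_measurable
  have h4 := S.W_measurable
  unfold env
  refine ((measurable_pi_lambda _ fun s => measurable_pi_lambda _ fun n => h1 s n).prodMk
    (measurable_pi_lambda _ fun j => measurable_pi_lambda _ fun n => h2 j n)).prodMk
    ((measurable_pi_lambda _ fun z => h3 z).prodMk (measurable_pi_lambda _ fun z =>
      measurable_pi_lambda _ fun i => measurable_pi_lambda _ fun l => h4 z i l))

/-- The conditional probability that the `e`-th Eve reaches the target SINR. -/
def intercept (β : ℝ) (e : ℕ) (ω : Ω) : ℝ≥0∞ :=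
  N.interceptProb k b β (S.pt .eve e ω) (fun j n => S.pt (.bs j) n ω) (fun j n => S.active j n ω)

lemma measurable_intercept (β : ℝ) (e : ℕ) : Measurable (S.intercept β e) := by
  have h1 := S.measurable_pt
  have h2 := S.active_measurable
  exact N.measurable_interceptProb k b β (h1 _ _)
    (measurable_pi_lambda _ fun j => measurable_pi_lambda _ fun n => h1 _ n)
    (measurable_pi_lambda _ fun j => measurable_pi_lambda _ fun n => h2 j n)

lemma measurable_sinr (e : ℕ) : Measurable (S.sinr e) := by
  rw [funext (S.sinr_eq e)]
  exact N.measurable_sinrAt k b e (measurable_pi_lambda _ fun z => S.hEve_measurable z e)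
    S.measurable_env

variable [IsProbabilityMeasure μ]

/-- Almost surely no Eve is at `b`, the beam of the serving BS is a unit vector and the weight
matrices are as required, so that `measure_le_sinrAt` applies. -/
lemma ae_measure_sinrAt_lt {β : ℝ} (hβ : 0 < β) (e : ℕ) :
    ∀ᵐ ω ∂μ, μ {ω' | N.sinrAt k b e (fun z => S.hEve z e ω') (S.env ω) < ENNReal.ofReal β}
      = 1 - S.intercept β e ω := by
  have hloc : ∀ᵐ ω ∂μ, ∀ n, S.pt .eve n ω ∉ ({b} : Set Plane) :=
    (S.poisson .eve).ae_notMem (measurableSet_singleton b) (homogeneous_eq_zero (by simp))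
  have hW := ae_all_iff.2 S.W_orthonormal
  have hU : ∀ᵐ ω ∂μ, S.hUser .serving ω ≠ 0 :=
    ae_ne_zero_of_hasLaw (S.hUser_law .serving) (zero_lt_two.trans_le (N.two_le_M k))
  filter_upwards [hloc, hW, hU] with ω h1 h2 h3
  have hm : MeasurableSet {ω' | ENNReal.ofReal β
      ≤ N.sinrAt k b e (fun z => S.hEve z e ω') (S.env ω)} := by
    exact measurableSet_le measurable_const (N.measurable_sinrAt k b e
      (measurable_pi_lambda _ fun z => S.hEve_measurable z e) measurable_const)
  have h4 := S.measure_le_sinrAt hβ e (S.env ω) (h1 e) (dotProduct_star_beam h3)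
    (fun z => (h2 z).1) (h2 .serving).2
  rw [show {ω' | N.sinrAt k b e (fun z => S.hEve z e ω') (S.env ω) < ENNReal.ofReal β}
    = {ω' | ENNReal.ofReal β ≤ N.sinrAt k b e (fun z => S.hEve z e ω') (S.env ω)}ᶜ by
      ext; simp, prob_compl_eq_one_sub hm, h4]
  rfl

/-- The factors of the secrecy probability. Given the positions and the activity, `S.env` still
depends on the channels to the served users and on the weight matrices, but the probability of
`ae_measure_sinrAt_lt` does not. -/
theorem condExp_sinr_lt {β : ℝ} (hβ : 0 < β) (e : ℕ) :
    μ⟦{ω | S.sinr e ω < ENNReal.ofReal β} | S.sites⟧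
      =ᵐ[μ] fun ω => (1 - S.intercept β e ω).toReal := by
  set T : Ω → (ℕ → Plane) × ((Fin K → ℕ → Plane) × (Fin K → ℕ → Bool)) :=
    fun ω => (fun e => S.pt .eve e ω, (fun j n => S.pt (.bs j) n ω, fun j n => S.active j n ω))
  set T' : N.Env k → (ℕ → Plane) × ((Fin K → ℕ → Plane) × (Fin K → ℕ → Bool)) :=
    fun y => (fun e => y.1.1 .eve e, (fun j n => y.1.1 (.bs j) n, y.1.2))
  have hT' : Measurable T' := by fun_prop
  have hT : Measurable T := hT'.comp S.measurable_env
  have hle : S.sites ≤ ‹MeasurableSpace Ω› := hT.comap_le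
  have hq := (S.measurable_intercept β e).const_sub 1
  have hq1 (ω) : (1 - S.intercept β e ω).toReal ≤ 1 := by
    simpa using ENNReal.toReal_mono ENNReal.one_ne_top
      (tsub_le_self : 1 - S.intercept β e ω ≤ 1)
  have hsinr : MeasurableSet {ω | S.sinr e ω < ENNReal.ofReal β} :=
    measurableSet_lt (S.measurable_sinr e) measurable_const
  have hint : Integrable (fun ω => (1 - S.intercept β e ω).toReal) μ :=
    Integrable.of_bound hq.ennreal_toReal.aestronglyMeasurable 1 (.of_forall fun ω => by
      rw [Real.norm_of_nonneg ENNReal.toReal_nonneg]; exact hq1 ω)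
  have hind : IndepFun (fun ω z => S.hEve z e ω) S.env μ :=
    S.hEve_indep.comp
      (φ := fun (h : (z : Tx k) → ℕ → Fin (N.M z.tier) → ℂ) (z : Tx k) => h z e)
      (by fun_prop) measurable_id
  have hHm : Measurable fun ω z => S.hEve z e ω :=
    measurable_pi_lambda _ fun z => S.hEve_measurable z e
  refine (ae_eq_condExp_of_forall_setIntegral_eq hle
    ((integrable_const (1 : ℝ)).indicator hsinr) (fun _ _ _ => hint.integrableOn) ?_ ?_).symm
  · rintro _ ⟨B, hB, rfl⟩ -
    have hA : MeasurableSet (T ⁻¹' B) := hT hB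
    set C : Set (((z : Tx k) → Fin (N.M z.tier) → ℂ) × N.Env k) :=
      (fun p => T' p.2) ⁻¹' B ∩ {p | N.sinrAt k b e p.1 p.2 < ENNReal.ofReal β}
    have hC : MeasurableSet C := (hB.preimage (hT'.comp measurable_snd)).inter
      (measurableSet_lt (N.measurable_sinrAt k b e measurable_fst measurable_snd) measurable_const)
    have h1 := hind.lintegral_comp_eq hHm S.measurable_env
      (F := fun h y => C.indicator 1 (h, y)) (measurable_one.indicator hC)
    have h2 : ∫⁻ ω, C.indicator 1 (fun z => S.hEve z e ω, S.env ω) ∂μ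
        = μ ({ω | S.sinr e ω < ENNReal.ofReal β} ∩ T ⁻¹' B) := by
      rw [inter_comm]
      exact lintegral_indicator_one (hC.preimage (hHm.prodMk S.measurable_env))
    have h3 : ∀ᵐ ω ∂μ, ∫⁻ ω', C.indicator 1 (fun z => S.hEve z e ω', S.env ω) ∂μ
        = (T ⁻¹' B).indicator (fun ω => 1 - S.intercept β e ω) ω := by
      filter_upwards [S.ae_measure_sinrAt_lt hβ e] with ω hω
      have h4 : ∫⁻ ω', C.indicator 1 (fun z => S.hEve z e ω', S.env ω) ∂μ
          = μ {ω' | (fun z => S.hEve z e ω', S.env ω) ∈ C} :=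
        lintegral_indicator_one (hC.preimage (hHm.prodMk measurable_const))
      rw [h4]
      by_cases hωB : T ω ∈ B
      · rw [indicator_of_mem (show ω ∈ T ⁻¹' B from hωB), ← hω]
        congr 1
        ext ω'
        exact ⟨fun h => h.2, fun h => ⟨hωB, h⟩⟩
      · rw [indicator_of_notMem (show ω ∉ T ⁻¹' B from hωB),
          show {ω' | (fun z => S.hEve z e ω', S.env ω) ∈ C} = ∅ from
            eq_empty_of_forall_notMem fun ω' h => hωB h.1, measure_empty]
    rw [h2, lintegral_congr_ae h3, lintegral_indicator hA] at h1
    rw [integral_toReal hq.aemeasurable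
      (.of_forall fun ω => tsub_le_self.trans_lt ENNReal.one_lt_top), ← h1,
      integral_indicator hsinr, Measure.restrict_restrict hsinr]
    simp [Measure.real]
    rfl
  · set G : (ℕ → Plane) × ((Fin K → ℕ → Plane) × (Fin K → ℕ → Bool)) → ℝ :=
      fun t => (1 - N.interceptProb k b β (t.1 e) t.2.1 t.2.2).toReal
    have hG : Measurable G :=
      ((N.measurable_interceptProb k b β (by fun_prop) (by fun_prop)
        (by fun_prop)).const_sub 1).ennreal_toReal
    have hTm : Measurable[S.sites] T := comap_measurable T
    have hGT : Measurable[S.sites] (G ∘ T) := hG.comp hTm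
    exact hGT.stronglyMeasurable.aestronglyMeasurable

lemma secrecyProb_eq {β : ℝ} (hβ : 0 < β) :
    S.secrecyProb β = (∫⁻ ω, infProd (fun e => 1 - S.intercept β e ω) ∂μ).toReal := by
  rw [secrecyProb, ← integral_toReal]
  · refine integral_congr_ae ?_
    filter_upwards [ae_all_iff.2 fun e => S.condExp_sinr_lt hβ e] with ω hω
    simp_rw [hω]
    exact tprod_toReal fun e => tsub_le_self
  · exact (Measurable.infProd fun e => (S.measurable_intercept β e).const_sub 1).aemeasurable
  · exact .of_forall fun ω => (infProd_le_one _).trans_lt ENNReal.one_lt_top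

end SecureTransmission

/-! ### Averaging over the BSs and the Eves -/

/-- Jensen's inequality for `e^{-x}`. -/
lemma ofReal_exp_neg_le_lintegral_expNeg {Ω : Type*} [MeasurableSpace Ω] {μ : Measure Ω}
    [IsProbabilityMeasure μ] {V : Ω → ℝ≥0∞} (hV : Measurable V) {m : ℝ} (hm : 0 ≤ m)
    (hVm : ∫⁻ ω, V ω ∂μ = ENNReal.ofReal m) :
    ENNReal.ofReal (Real.exp (-m)) ≤ ∫⁻ ω, expNeg (V ω) ∂μ := by
  set c := ENNReal.ofReal (Real.exp (-m))
  -- the tangent line of `e^{-x}` at `m`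
  have htan (v : ℝ≥0∞) : c + c * ENNReal.ofReal m ≤ expNeg v + c * v := by
    induction v using ENNReal.recTopCoe with
    | top =>
      have hc : c ≠ 0 := by simp [c, Real.exp_pos]
      simp [ENNReal.mul_top hc]
    | coe v =>
      rw [← ENNReal.ofReal_coe_nnreal, expNeg_ofReal v.coe_nonneg,
        ← ENNReal.ofReal_mul (Real.exp_pos _).le, ← ENNReal.ofReal_mul (Real.exp_pos _).le,
        ← ENNReal.ofReal_add (Real.exp_pos _).le (by positivity),
        ← ENNReal.ofReal_add (Real.exp_pos _).le (by positivity)]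
      refine ENNReal.ofReal_le_ofReal ?_
      have h1 : Real.exp (-(v : ℝ)) = Real.exp (-m) * Real.exp (m - v) := by
        rw [← Real.exp_add]; congr 1; ring
      have h2 := mul_le_mul_of_nonneg_left (Real.add_one_le_exp (m - v)) (Real.exp_pos (-m)).le
      rw [h1]
      linarith
  have h := lintegral_mono (μ := μ) fun ω => htan (V ω)
  rw [lintegral_const, measure_univ, mul_one, lintegral_add_left (by fun_prop),
    lintegral_const_mul _ hV, hVm] at h
  exact (ENNReal.add_le_add_iff_right
    (ENNReal.mul_ne_top ENNReal.ofReal_ne_top ENNReal.ofReal_ne_top)).1 h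

/-- A homogeneous process has `t` points on average within `√(t / (π ℓ))` of `b`. -/
lemma homogeneous_setOf_le {ℓ : ℝ} (hℓ : 0 < ℓ) (b : Plane) {t : ℝ} (ht : 0 < t) :
    homogeneous ℓ {x | ENNReal.ofReal (Real.pi * ℓ * dist x b ^ 2) ≤ ENNReal.ofReal t}
      = ENNReal.ofReal t := by
  have hπ := Real.pi_pos
  have h1 : {x | ENNReal.ofReal (Real.pi * ℓ * dist x b ^ 2) ≤ ENNReal.ofReal t}
      = Metric.closedBall b (Real.sqrt (t / (Real.pi * ℓ))) := by
    ext x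
    rw [mem_ofPred_eq, ENNReal.ofReal_le_ofReal_iff ht.le, Metric.mem_closedBall,
      Real.le_sqrt dist_nonneg (by positivity), le_div_iff₀ (by positivity), mul_comm]
  rw [h1, homogeneous, Measure.smul_apply, smul_eq_mul, Measure.addHaar_closedBall_eq_addHaar_ball,
    Plane.volume_ball _ _ (Real.sqrt_nonneg _), Real.sq_sqrt (by positivity),
    ← ENNReal.ofReal_mul hℓ.le]
  congr 1
  field_simp

namespace Network

variable {K : ℕ} (N : Network K)

lemma one_add_ξ_mul_pos (k : Fin K) {β : ℝ} (hβ : 0 < β) : 0 < 1 + N.ξ k * β := by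
  have := N.ξ_nonneg k
  positivity

/-- The interference functional of tier `j`. -/
lemma lintegral_one_sub_bsFactor (k : Fin K) (b : Plane) {β : ℝ} (hβ : 0 < β) (x : Plane)
    (j : Fin K) :
    ∫⁻ y, (1 - N.bsFactor k b β x j y)
      = ENNReal.ofReal (Real.pi * (N.C (N.M j) *
          ((N.ξ j * (N.φ j / N.φ k) * (N.P j / N.P k)) ^ N.δ * β ^ N.δ * dist x b ^ 2))) := by
  have hξ := N.ξ_nonneg j
  have hφj := N.φ_pos j
  have hφk := N.φ_pos k
  have hPj := N.P_pos j
  have hPk := N.P_pos k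
  have hα := N.α_pos
  have ht := N.noiseRatio_nonneg k hβ j
  have h1 (y : Plane) : 1 - N.bsFactor k b β x j y = (fun v : Plane => 1 -
      ENNReal.ofReal (((1 + N.noiseRatio k β j * dist b x ^ N.α / ‖v‖ ^ N.α) ^ (N.M j - 1))⁻¹))
      (y - x) := by
    simp only [bsFactor, dist_eq_norm]
  have hM : ((N.M j - 1 : ℕ) : ℝ) = (N.M j : ℝ) - 1 := by
    rw [Nat.cast_sub (by have := N.two_le_M j; omega), Nat.cast_one]
  simp_rw [h1]
  rw [lintegral_sub_right_eq_self (fun v : Plane => 1 - ENNReal.ofReal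
      (((1 + N.noiseRatio k β j * dist b x ^ N.α / ‖v‖ ^ N.α) ^ (N.M j - 1))⁻¹)) x,
    lintegral_one_sub_inv_one_add_div_norm_rpow N.two_lt_α (by positivity)
      (by have := N.two_le_M j; omega), hM]
  have h2 : (N.noiseRatio k β j * dist b x ^ N.α) ^ (2 / N.α)
      = (N.ξ j * (N.φ j / N.φ k) * (N.P j / N.P k)) ^ N.δ * β ^ N.δ * dist x b ^ 2 := by
    rw [Real.mul_rpow ht (by positivity), ← Real.rpow_mul dist_nonneg,
      mul_div_cancel₀ _ hα.ne', Real.rpow_two, dist_comm, noiseRatio,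
      Real.mul_rpow hβ.le (by positivity), δ, mul_comm (β ^ (2 / N.α))]
  rw [h2, C, mul_comm (_ * dist x b ^ 2)]

end Network

namespace SecureTransmission

variable {K : ℕ} {N : Network K} {k : Fin K} {b : Plane} {Ω : Type*} [MeasurableSpace Ω]
  {μ : Measure Ω} (S : SecureTransmission N k b μ)

lemma measurable_eves : Measurable fun ω e => S.pt .eve e ω :=
  measurable_pi_lambda _ fun e => S.measurable_pt _ e

lemma measurable_bss : Measurable fun ω (j : Fin K) n => S.pt (.bs j) n ω :=
  measurable_pi_lambda _ fun _ => measurable_pi_lambda _ fun n => S.measurable_pt _ n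

lemma measurable_activity : Measurable fun ω j n => S.active j n ω :=
  measurable_pi_lambda _ fun j => measurable_pi_lambda _ fun n => S.active_measurable j n

/-- The average number of Eves that reach the target SINR, given the BSs. -/
def meanIntercepts (β : ℝ) (ω : Ω) : ℝ≥0∞ :=
  ∫⁻ x, N.interceptProb k b β x (fun j n => S.pt (.bs j) n ω) (fun j n => S.active j n ω)
    ∂homogeneous N.lamE

lemma measurable_interceptProb_uncurry (β : ℝ) : Measurable fun p : Ω × Plane =>
    N.interceptProb k b β p.2 (fun j n => S.pt (.bs j) n p.1) (fun j n => S.active j n p.1) :=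
  N.measurable_interceptProb k b β measurable_snd (S.measurable_bss.comp measurable_fst)
    (S.measurable_activity.comp measurable_fst)

lemma measurable_meanIntercepts (β : ℝ) : Measurable (S.meanIntercepts β) :=
  (S.measurable_interceptProb_uncurry β).lintegral_prod_right'

variable [IsProbabilityMeasure μ]

/-- The Eves are independent of the BSs and their activity. -/
lemma indepFun_eve :
    IndepFun (fun ω e => S.pt .eve e ω)
      (fun ω => ((fun j n => S.pt (.bs j) n ω : Fin K → ℕ → Plane),
        fun j n => S.active j n ω)) μ := by
  have hE := S.measurable_eves
  have hB := S.measurable_bss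
  refine IndepFun.prodMk_right_of_indepFun_prodMk hE hB S.measurable_activity ?_ ?_
  · have h := S.indep.indepFun_pi_ne
      (fun s => measurable_pi_lambda _ fun n => S.measurable_pt s n) .eve
    have hne (j : Fin K) : (Node.bs j : Node K) ≠ .eve := by simp
    exact h.comp (ψ := fun (v : {s : Node K // s ≠ .eve} → ℕ → Plane) (j : Fin K) n =>
      v ⟨.bs j, hne j⟩ n) measurable_id (by fun_prop)
  · exact S.active_indep.comp (ψ := fun (v : Node K → ℕ → Plane) =>
      ((fun e => v .eve e), fun (j : Fin K) n => v (.bs j) n)) measurable_id (by fun_prop)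

/-- The average over the BSs of the conditional probability that an Eve at `x` reaches the target
SINR. -/
lemma lintegral_interceptProb {β : ℝ} (hβ : 0 < β) (x : Plane) :
    ∫⁻ ω, N.interceptProb k b β x (fun j n => S.pt (.bs j) n ω) (fun j n => S.active j n ω) ∂μ
      = ENNReal.ofReal ((1 + N.ξ k * β) ^ (N.M k - 1))⁻¹ *
        ENNReal.ofReal (N.lowerIntegrand S.activationProb k β (dist x b ^ 2)) := by
  have hφ := N.φ_pos k
  have hP := N.P_pos k
  have hN0 := N.N0_nonneg
  have hA (j) : 0 ≤ S.activationProb j := measureReal_nonneg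
  have hthin := lintegral_prod_infProd_thinning (μ := μ) (X := fun j n => S.pt (.bs j) n)
    (Λ := fun j => homogeneous (N.lam j)) (fun j => S.poisson (.bs j))
    (S.indep.precomp (g := Node.bs) fun i j h => by simpa using h) S.active_measurable
    S.active_prob S.active_iIndep
    (S.active_indep.comp (ψ := fun (v : Node K → ℕ → Plane) (j : Fin K) n => v (.bs j) n)
      measurable_id (by fun_prop))
    (f := fun j y => N.bsFactor k b β x j y)
    (fun j => N.measurable_bsFactor k b β j measurable_const measurable_id)
    (fun j y => N.bsFactor_le_one k b hβ x j y)
  have hm (j n) : Measurable fun ω =>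
      if S.active j n ω = true then N.bsFactor k b β x j (S.pt (.bs j) n ω) else 1 :=
    Measurable.ite (measurableSet_eq_fun (S.active_measurable j n) measurable_const)
      (N.measurable_bsFactor k b β j measurable_const (S.measurable_pt _ n)) measurable_const
  unfold Network.interceptProb
  rw [lintegral_const_mul _ ((Finset.measurable_prod _ fun j _ =>
      Measurable.infProd fun n => hm j n).const_mul _),
    lintegral_const_mul _ (Finset.measurable_prod _ fun j _ => Measurable.infProd fun n => hm j n),
    hthin]
  congr 1
  have hC (j) : 0 ≤ N.C (N.M j) := by
    have hα := N.two_lt_α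
    have hα0 := N.α_pos
    have hδ1 : 2 / N.α < 1 := by rw [div_lt_one hα0]; exact hα
    have hδ0 : 0 < 2 / N.α := by positivity
    have hM := N.M_sub_one_pos j
    have h1 := Real.Gamma_pos_of_pos hM
    have h2 := Real.Gamma_pos_of_pos (show 0 < (N.M j : ℝ) - 1 + 2 / N.α by positivity)
    have h3 := Real.Gamma_pos_of_pos (show 0 < 1 - 2 / N.α by linarith)
    unfold Network.C
    positivity
  have ht (j) : 0 ≤ N.ξ j * (N.φ j / N.φ k) * (N.P j / N.P k) := by
    have := N.ξ_nonneg j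
    have := N.φ_pos j
    have := N.P_pos j
    positivity
  simp_rw [lintegral_homogeneous, N.lintegral_one_sub_bsFactor k b hβ x]
  have hterm (j) : ENNReal.ofReal (S.activationProb j) * (ENNReal.ofReal (N.lam j) *
      ENNReal.ofReal (Real.pi * (N.C (N.M j) * ((N.ξ j * (N.φ j / N.φ k) * (N.P j / N.P k)) ^ N.δ *
        β ^ N.δ * dist x b ^ 2))))
      = ENNReal.ofReal (Real.pi * (S.activationProb j * N.lam j * N.C (N.M j) *
        (N.ξ j * (N.φ j / N.φ k) * (N.P j / N.P k)) ^ N.δ) * β ^ N.δ * dist x b ^ 2) := by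
    rw [← ENNReal.ofReal_mul (N.lam_pos j).le, ← ENNReal.ofReal_mul (hA j)]
    congr 1; ring
  have hterm0 (j) : 0 ≤ Real.pi * (S.activationProb j * N.lam j * N.C (N.M j) *
      (N.ξ j * (N.φ j / N.φ k) * (N.P j / N.P k)) ^ N.δ) * β ^ N.δ * dist x b ^ 2 := by
    have := hA j
    have := N.lam_pos j
    have := hC j
    have := ht j
    have := Real.pi_pos
    positivity
  simp_rw [hterm]
  rw [← expNeg_sum, ← ENNReal.ofReal_sum_of_nonneg fun j _ => hterm0 j, ← expNeg_add,
    ← ENNReal.ofReal_add (by positivity) (Finset.sum_nonneg fun j _ => hterm0 j),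
    expNeg_ofReal (add_nonneg (by positivity) (Finset.sum_nonneg fun j _ => hterm0 j)),
    Network.lowerIntegrand, Network.ψ]
  have hpow : (dist x b ^ 2) ^ (N.α / 2) = dist b x ^ N.α := by
    rw [← Real.rpow_two, ← Real.rpow_mul dist_nonneg, mul_div_cancel₀ _ two_ne_zero, dist_comm]
  rw [hpow, ← Finset.sum_mul, ← Finset.sum_mul, ← Finset.mul_sum]
  congr 2
  ring

/-- The average over the Eves, given the BSs. -/
lemma lintegral_infProd_intercept {β : ℝ} (hβ : 0 < β) :
    ∫⁻ ω, infProd (fun e => 1 - S.intercept β e ω) ∂μ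
      = ∫⁻ ω, expNeg (S.meanIntercepts β ω) ∂μ := by
  have hF : Measurable fun q : (ℕ → Plane) × ((Fin K → ℕ → Plane) × (Fin K → ℕ → Bool)) =>
      infProd fun e => 1 - N.interceptProb k b β (q.1 e) q.2.1 q.2.2 :=
    Measurable.infProd fun e => (N.measurable_interceptProb k b β (by fun_prop) (by fun_prop)
      (by fun_prop)).const_sub 1
  have h := S.indepFun_eve.lintegral_comp_eq S.measurable_eves
    (S.measurable_bss.prodMk S.measurable_activity)
    (F := fun x z => infProd fun e => 1 - N.interceptProb k b β (x e) z.1 z.2) hF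
  refine h.trans (lintegral_congr fun ω => ?_)
  exact (S.poisson .eve).lintegral_infProd_one_sub
    (N.measurable_interceptProb k b β measurable_id measurable_const measurable_const)
    fun x => N.interceptProb_le_one k b hβ x _ _

/-- The average over the BSs of an integral over the plane of the interception probability. -/
lemma lintegral_lintegral_interceptProb {β : ℝ} (hβ : 0 < β) {g : ℝ → ℝ≥0∞} (hg : Measurable g) :
    ∫⁻ ω, ∫⁻ x, N.interceptProb k b β x (fun j n => S.pt (.bs j) n ω)
      (fun j n => S.active j n ω) * g (dist x b ^ 2) ∂homogeneous N.lamE ∂μ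
      = ENNReal.ofReal (Real.pi * N.lamE / (1 + N.ξ k * β) ^ (N.M k - 1)) *
        ∫⁻ r in Ioi (0 : ℝ),
          ENNReal.ofReal (N.lowerIntegrand S.activationProb k β r) * g r := by
  have hξ := N.one_add_ξ_mul_pos k hβ
  have hlow : Measurable (N.lowerIntegrand S.activationProb k β) := by
    unfold Network.lowerIntegrand; fun_prop
  have hmeas := S.measurable_interceptProb_uncurry β
  have hg2 : Measurable fun q : Ω × Plane => g (dist q.2 b ^ 2) := by fun_prop
  rw [lintegral_lintegral_swap (hmeas.mul hg2).aemeasurable]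
  have h1 (x : Plane) : ∫⁻ ω, N.interceptProb k b β x (fun j n => S.pt (.bs j) n ω)
      (fun j n => S.active j n ω) * g (dist x b ^ 2) ∂μ
      = ENNReal.ofReal ((1 + N.ξ k * β) ^ (N.M k - 1))⁻¹ *
        (fun r => ENNReal.ofReal (N.lowerIntegrand S.activationProb k β r) * g r)
          (dist x b ^ 2) := by
    have hx : Measurable fun ω => N.interceptProb k b β x (fun j n => S.pt (.bs j) n ω)
        (fun j n => S.active j n ω) :=
      N.measurable_interceptProb k b β measurable_const S.measurable_bss S.measurable_activity
    rw [lintegral_mul_const _ hx, S.lintegral_interceptProb hβ x,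
      mul_assoc]
  simp_rw [h1]
  rw [lintegral_homogeneous, lintegral_const_mul _ (by fun_prop),
    lintegral_comp_dist_sq (fun r hr => Plane.volume_ball b r hr)
      (F := fun r => ENNReal.ofReal (N.lowerIntegrand S.activationProb k β r) * g r)
      (by fun_prop), ← mul_assoc,
    ← mul_assoc, ← ENNReal.ofReal_mul N.lamE_pos.le,
    ← ENNReal.ofReal_mul (mul_nonneg N.lamE_pos.le (by positivity))]
  congr 2
  rw [div_eq_mul_inv]; ring

theorem lowerBound_le_secrecyProb {β : ℝ} (hβ : 0 < β) :
    N.lowerBound S.activationProb k β ≤ S.secrecyProb β := by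
  have hξ := N.one_add_ξ_mul_pos k hβ
  have hπ := Real.pi_pos
  have hlam := N.lamE_pos
  rw [Network.lowerBound, S.secrecyProb_eq hβ, S.lintegral_infProd_intercept hβ]
  split_ifs with hint
  · have hpos (r : ℝ) : 0 ≤ N.lowerIntegrand S.activationProb k β r := (Real.exp_pos _).le
    set m := Real.pi * N.lamE / (1 + N.ξ k * β) ^ (N.M k - 1) *
      ∫ r in Ioi (0 : ℝ), N.lowerIntegrand S.activationProb k β r
    have hI : 0 ≤ ∫ r in Ioi (0 : ℝ), N.lowerIntegrand S.activationProb k β r :=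
      integral_nonneg hpos
    have hm : 0 ≤ m := mul_nonneg (by positivity) hI
    have hV : ∫⁻ ω, S.meanIntercepts β ω ∂μ = ENNReal.ofReal m := by
      have h := S.lintegral_lintegral_interceptProb hβ (g := fun _ => 1) measurable_const
      simp only [mul_one] at h
      rw [ENNReal.ofReal_mul (by positivity),
        ofReal_integral_eq_lintegral_ofReal hint (.of_forall hpos), ← h]
      rfl
    have h := ofReal_exp_neg_le_lintegral_expNeg (S.measurable_meanIntercepts β) hm hV
    rw [← ENNReal.toReal_ofReal (Real.exp_pos (-m)).le]
    refine ENNReal.toReal_mono ?_ h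
    exact ((lintegral_mono fun ω => expNeg_le_one _).trans_lt (by simp)).ne
  · exact ENNReal.toReal_nonneg

theorem secrecyProb_le_upperBound {β : ℝ} (hβ : 0 < β) :
    S.secrecyProb β ≤ N.upperBound S.activationProb k β := by
  have hξ := N.one_add_ξ_mul_pos k hβ
  have hπ := Real.pi_pos
  have hlam := N.lamE_pos
  have hlow : Measurable (N.lowerIntegrand S.activationProb k β) := by
    unfold Network.lowerIntegrand; fun_prop
  set g : ℝ → ℝ≥0∞ := fun r => expNeg (ENNReal.ofReal (Real.pi * N.lamE * r)) with hg_def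
  have hg : Measurable g := by fun_prop
  have hmeas := S.measurable_interceptProb_uncurry β
  -- `g` bounds from below the probability that no other Eve is nearer to `b`
  have hpt (ω : Ω) : expNeg (S.meanIntercepts β ω) + ∫⁻ x, N.interceptProb k b β x
      (fun j n => S.pt (.bs j) n ω) (fun j n => S.active j n ω) * g (dist x b ^ 2)
        ∂homogeneous N.lamE ≤ 1 := by
    set p : Plane → ℝ≥0∞ := fun x =>
      N.interceptProb k b β x (fun j n => S.pt (.bs j) n ω) (fun j n => S.active j n ω)
    have hp : Measurable p :=
      N.measurable_interceptProb k b β measurable_id measurable_const measurable_const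
    have h := expNeg_add_lintegral_expNeg_le_one ((homogeneous N.lamE).withDensity p)
      (h := fun x => ENNReal.ofReal (Real.pi * N.lamE * dist x b ^ 2)) (by fun_prop)
      fun t ht => by
        rw [withDensity_apply _ (measurableSet_le (by fun_prop) (by fun_prop))]
        refine (lintegral_mono (g := fun _ => 1)
          fun x => N.interceptProb_le_one k b hβ x _ _).trans ?_
        rw [setLIntegral_one, homogeneous_setOf_le hlam b ht]
    rw [withDensity_apply _ MeasurableSet.univ, setLIntegral_univ,
      lintegral_withDensity_eq_lintegral_mul _ hp (by fun_prop)] at h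
    exact h
  have hsum := lintegral_mono (μ := μ) hpt
  have hV : Measurable fun ω => expNeg (S.meanIntercepts β ω) :=
    measurable_expNeg.comp (S.measurable_meanIntercepts β)
  rw [lintegral_add_left hV,
    S.lintegral_lintegral_interceptProb hβ hg, lintegral_one, measure_univ] at hsum
  have hint : ∫ r in Ioi (0 : ℝ), Real.exp (-(β * N.N0 / (N.φ k * N.P k)) * r ^ (N.α / 2)
      - Real.pi * N.ψ S.activationProb k * β ^ N.δ * r - Real.pi * N.lamE * r)
      = (∫⁻ r in Ioi (0 : ℝ),
          ENNReal.ofReal (N.lowerIntegrand S.activationProb k β r) * g r).toReal := by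
    rw [integral_eq_lintegral_of_nonneg_ae (.of_forall fun r => (Real.exp_pos _).le)
      (Measurable.aestronglyMeasurable (by fun_prop))]
    congr 1
    refine setLIntegral_congr_fun measurableSet_Ioi fun r (hr : 0 < r) => ?_
    simp only [hg_def]
    rw [expNeg_ofReal (by positivity), Network.lowerIntegrand,
      ← ENNReal.ofReal_mul (Real.exp_pos _).le, ← Real.exp_add]
    rfl
  rw [Network.upperBound, hint, S.secrecyProb_eq hβ, S.lintegral_infProd_intercept hβ,
    le_sub_iff_add_le]
  have hle := ENNReal.toReal_mono ENNReal.one_ne_top hsum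
  rwa [ENNReal.toReal_add, ENNReal.toReal_mul, ENNReal.toReal_ofReal (by positivity),
    ENNReal.toReal_one] at hle
  · exact ((le_self_add.trans hsum).trans_lt ENNReal.one_lt_top).ne
  · exact ((le_add_self.trans hsum).trans_lt ENNReal.one_lt_top).ne

end SecureTransmission

end

/-- Bounds on the secrecy probability against non-colluding Eves. -/
theorem theorem2 {K : ℕ} (N : Network K) (k : Fin K) (b : Plane)
    {Ω : Type*} [MeasurableSpace Ω] (μ : Measure Ω) [IsProbabilityMeasure μ]
    (S : SecureTransmission N k b μ) (β : ℝ) (hβ : 0 < β) :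
    N.lowerBound S.activationProb k β ≤ S.secrecyProb β ∧
      S.secrecyProb β ≤ N.upperBound S.activationProb k β :=
  ⟨S.lowerBound_le_secrecyProb hβ, S.secrecyProb_le_upperBound hβ⟩
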